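/- Let $N\in\mathbb N$, $h=1/(N+1)$, $x_j=jh$, $x_{j+1/2}=(j+1/2)h$. Write vectors of $\mathbb C^{2N+1}$ as $\mathbf F=(F_{j/2})_{1\le j\le 2N+1}$, with $F_0=F_{N+1}=0$. Let $M_h$ and $S_h$ be the $(2N+1)\times(2N+1)$ mass and stiffness matrices of the continuous piecewise quadratic finite elements on this grid, with homogeneous Dirichlet conditions: for $0\le j\le N$, $$(M_h\mathbf F)_{j+1/2}=\tfrac{h}{15}\left(F_j+8F_{j+1/2}+F_{j+1}\right),\qquad (S_h\mathbf F)_{j+1/2}=\tfrac{8}{3h}\left(-F_j+2F_{j+1/2}-F_{j+1}\right),$$ and for $1\le j\le N$, $$(M_h\mathbf F)_j=\tfrac{h}{30}\left(-F_{j-1}+2F_{j-1/2}+8F_j+2F_{j+1/2}-F_{j+1}\right),\qquad (S_h\mathbf F)_j=\tfrac{1}{3h}\left(F_{j-1}-8F_{j-1/2}+14F_j-8F_{j+1/2}+F_{j+1}\right).$$ With the Euclidean inner product $(\cdot,\cdot)$ of $\mathbb C^{2N+1}$, put $\|\mathbf F\|_{h,0}^2=(M_h\mathbf F,\mathbf F)$,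 $\|\mathbf F\|_{h,1}^2=(S_h\mathbf F,\mathbf F)$, $\mathcal E_h(\mathbf U^0,\mathbf U^1)=\tfrac12\left(\|\mathbf U^0\|_{h,1}^2+\|\mathbf U^1\|_{h,0}^2\right)$. Let $B_h$ be the $(2N+1)\times(2N+1)$ matrix whose only nonzero entry is $-1/h$ at position $(2N+1,2N)$ (and $B_h=0$ if $N=0$), so that $\|B_h\mathbf U\|^2=|U_N/h|^2$. For $\eta\in[0,\pi]$ let $\Delta(\eta)=1+268\cos^2(\eta/2)-44\cos^4(\eta/2)$, $$\Lambda^a(\eta)=\frac{120\sin^2(\eta/2)}{11+4\cos^2(\eta/2)+\sqrt{\Delta(\eta)}},\qquad \Lambda^o(\eta)=\frac{22+8\cos^2(\eta/2)+2\sqrt{\Delta(\eta)}}{1+\sin^2(\eta/2)},$$ and $\lambda^\alpha=\sqrt{\Lambda^\alpha}$ for $\alpha\in\{a,o\}$; derivatives on $[0,\pi]$ are one-sided at the endpoints. For $1\le k\le N$ let $\Lambda^{\alpha,k}=\Lambda^\alpha(k\pi h)$ and let $\varphi^{\alpha,k}_h$ be the vector with components $$\sin(k\pi x_j)\ (1\le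 j\le N),\qquad \frac{40+\Lambda^{\alpha,k}}{4(10-\Lambda^{\alpha,k})}\cos\left(\frac{k\pi h}{2}\right)\sin(k\pi x_{j+1/2})\ (0\le j\le N),$$ normalized in $\|\cdot\|_{h,0}$. These are the acoustic ($\alpha=a$) and optic ($\alpha=o$) modes. Let $0<\Lambda^a_+<10$ and $12<\Lambda^o_-\le\Lambda^o_+<60$ be independent of $h$, and let $\eta^a_+=(\Lambda^a)^{-1}(\Lambda^a_+)$, $\eta^o_\pm=(\Lambda^o)^{-1}(\Lambda^o_\pm)$ be the corresponding wave numbers in $[0,\pi]$. Let $$\mathcal T_h=\mathrm{span}\{\varphi^{a,k}_h:\ 1\le k\le N,\ k\pi h\le\eta^a_+\}\oplus\mathrm{span}\{\varphi^{o,k}_h:\ 1\le k\le N,\ \eta^o_+\le k\pi h\le\eta^o_-\}\subset\mathbb C^{2N+1}.$$ Then the minima $v^a=\min_{\eta\in[0,\eta^a_+]}\partial_\eta\lambda^a(\eta)$ and $v^o=\min_{\eta\in[\eta^o_+,\eta^o_-]}(-\partial_\eta\lambda^o(\eta))$ exist and are strictly positive, and the following hold for the solutions of $$M_h\mathbf U_h''(t)+S_h\mathbf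 U_h(t)=0\ \ (0\le t\le T),\qquad \mathbf U_h(T)=\mathbf U^0_h,\quad \mathbf U_h'(T)=\mathbf U^1_h.$$ (i) (Observability.) For every $T>T^\star:=2/\min\{v^a,v^o\}$ there is a constant $C>0$, depending only on $T,\Lambda^a_+,\Lambda^o_-,\Lambda^o_+$ (not on $h$), such that for all $N$ and all $\mathbf U^0_h,\mathbf U^1_h\in\mathcal T_h$, $$\mathcal E_h(\mathbf U^0_h,\mathbf U^1_h)\le C\int_0^T\|B_h\mathbf U_h(t)\|^2\,dt.$$ (ii) (Admissibility.) For every $T>0$ there is a constant $c>0$, depending only on $T,\Lambda^a_+,\Lambda^o_-,\Lambda^o_+$, such that for all $N$ and all $\mathbf U^0_h,\mathbf U^1_h\in\mathcal T_h$, $$c\int_0^T\|B_h\mathbf U_h(t)\|^2\,dt\le\mathcal E_h(\mathbf U^0_h,\mathbf U^1_h).$$ -/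

import Mathlib

noncomputable section

namespace P2Wave

/-- The mesh size `h = 1 / (N + 1)`. -/
def mesh (N : ℕ) : ℝ := 1 / ((N : ℝ) + 1)

/-- Coefficient vectors `(U_{1/2}, U_1, …, U_{N+1/2})` of a continuous piecewise quadratic function
vanishing at both ends of `[0, 1]`. The (zero-based) position `i` carries the coefficient at the
point `x = (i + 1) h / 2`: a midpoint of the grid if `i` is even, a node if `i` is odd. -/
abbrev Vec (N : ℕ) := Fin (2 * N + 1) → ℂ

/-- The pentadiagonal `P₂` mass matrix. -/
def massMatrix (N : ℕ) : Matrix (Fin (2 * N + 1)) (Fin (2 * N + 1)) ℝ := fun i j =>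
  if i = j then (if Even i.val then 8 * mesh N / 15 else 4 * mesh N / 15)
  else if i.val + 1 = j.val ∨ j.val + 1 = i.val then mesh N / 15
  else if (i.val + 2 = j.val ∨ j.val + 2 = i.val) ∧ Odd i.val then -(mesh N / 30)
  else 0

/-- The pentadiagonal `P₂` stiffness matrix. -/
def stiffnessMatrix (N : ℕ) : Matrix (Fin (2 * N + 1)) (Fin (2 * N + 1)) ℝ := fun i j =>
  if i = j then (if Even i.val then 16 / (3 * mesh N) else 14 / (3 * mesh N))
  else if i.val + 1 = j.val ∨ j.val + 1 = i.val then -(8 / (3 * mesh N))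
  else if (i.val + 2 = j.val ∨ j.val + 2 = i.val) ∧ Odd i.val then 1 / (3 * mesh N)
  else 0

/-- The boundary observation matrix, whose only nonzero entry `-1/h` stands in the last row and the
penultimate column (and so picks the coefficient at the last interior node `x_N`). -/
def observationMatrix (N : ℕ) : Matrix (Fin (2 * N + 1)) (Fin (2 * N + 1)) ℝ := fun i j =>
  if i.val = 2 * N ∧ j.val + 1 = 2 * N then -(1 / mesh N) else 0

/-- A real matrix acting on complex vectors. -/
def act {N : ℕ} (A : Matrix (Fin (2 * N + 1)) (Fin (2 * N + 1)) ℝ) (F : Vec N) : Vec N :=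
  (A.map Complex.ofReal).mulVec F

/-- The Euclidean inner product `∑ F_k conj(G_k)` of `ℂ^{2N+1}`. -/
def euclInner {N : ℕ} (F G : Vec N) : ℂ := ∑ k, F k * (starRingEnd ℂ) (G k)

/-- The squared Euclidean norm of `ℂ^{2N+1}`. -/
def euclNormSq {N : ℕ} (F : Vec N) : ℝ := ∑ k, ‖F k‖ ^ 2

/-- The squared discrete `L²` norm `(M_h F, F)`. -/
def normSqZero {N : ℕ} (F : Vec N) : ℝ := (euclInner (act (massMatrix N) F) F).re

/-- The squared discrete `H¹₀` norm `(S_h F, F)`. -/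
def normSqOne {N : ℕ} (F : Vec N) : ℝ := (euclInner (act (stiffnessMatrix N) F) F).re

/-- The total energy of the data `(U⁰, U¹)`. -/
def energy {N : ℕ} (U₀ U₁ : Vec N) : ℝ := (1 / 2) * (normSqOne U₀ + normSqZero U₁)

/-- `U` solves `M_h U'' + S_h U = 0` on `[0, T]`, with `U(T) = U⁰` and `U'(T) = U¹`. -/
def IsSolution (N : ℕ) (T : ℝ) (U₀ U₁ : Vec N) (U : ℝ → Vec N) : Prop :=
  ∃ V A : ℝ → Vec N,
    (∀ t ∈ Set.Icc 0 T, HasDerivWithinAt U (V t) (Set.Icc 0 T) t) ∧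
    (∀ t ∈ Set.Icc 0 T, HasDerivWithinAt V (A t) (Set.Icc 0 T) t) ∧
    (∀ t ∈ Set.Icc 0 T, act (massMatrix N) (A t) + act (stiffnessMatrix N) (U t) = 0) ∧
    U T = U₀ ∧ V T = U₁

/-- The discriminant appearing in the Fourier symbols. -/
def discr (η : ℝ) : ℝ := 1 + 268 * Real.cos (η / 2) ^ 2 - 44 * Real.cos (η / 2) ^ 4

/-- The acoustic Fourier symbol `Λᵃ`. -/
def acousticSymbol (η : ℝ) : ℝ :=
  120 * Real.sin (η / 2) ^ 2 / (11 + 4 * Real.cos (η / 2) ^ 2 + Real.sqrt (discr η))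

/-- The optic Fourier symbol `Λᵒ`. -/
def opticSymbol (η : ℝ) : ℝ :=
  (22 + 8 * Real.cos (η / 2) ^ 2 + 2 * Real.sqrt (discr η)) / (1 + Real.sin (η / 2) ^ 2)

/-- The acoustic dispersion relation. -/
def acousticDispersion (η : ℝ) : ℝ := Real.sqrt (acousticSymbol η)

/-- The optic dispersion relation. -/
def opticDispersion (η : ℝ) : ℝ := Real.sqrt (opticSymbol η)

/-- The acoustic group velocity on `[0, π]` (one-sided derivatives at the ends: the dispersion
relation has a corner at `0`). -/
def acousticVelocity (η : ℝ) : ℝ := derivWithin acousticDispersion (Set.Icc 0 Real.pi) η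

/-- The optic group velocity on `[0, π]`, with the sign that makes it positive inside. -/
def opticVelocity (η : ℝ) : ℝ := -derivWithin opticDispersion (Set.Icc 0 Real.pi) η

/-- The inverse of the acoustic symbol, as a function on `[0, π]`. -/
def acousticWaveNumber (L : ℝ) : ℝ := Function.invFunOn acousticSymbol (Set.Icc 0 Real.pi) L

/-- The inverse of the optic symbol, as a function on `[0, π]`. -/
def opticWaveNumber (L : ℝ) : ℝ := Function.invFunOn opticSymbol (Set.Icc 0 Real.pi) L

/-- The eigenvector with wave number `k` and normalized eigenvalue `L`: nodal components
`sin(kπx)`, midpoint components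
`(40 + L) / (4 (10 - L)) * cos(kπh/2) * sin(kπx)`. -/
def rawMode (N k : ℕ) (L : ℝ) : Vec N := fun i =>
  let x : ℝ := ((i.val : ℝ) + 1) * mesh N / 2
  if Odd i.val then ((Real.sin (k * Real.pi * x) : ℝ) : ℂ)
  else (((40 + L) / (4 * (10 - L)) * Real.cos (k * Real.pi * mesh N / 2)
    * Real.sin (k * Real.pi * x) : ℝ) : ℂ)

/-- Normalization in the discrete `L²` norm. -/
def normalize {N : ℕ} (F : Vec N) : Vec N := (((Real.sqrt (normSqZero F))⁻¹ : ℝ) : ℂ) • F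

/-- The normalized acoustic eigenvector with wave number `k`. -/
def acousticMode (N k : ℕ) : Vec N :=
  normalize (rawMode N k (acousticSymbol (k * Real.pi * mesh N)))

/-- The normalized optic eigenvector with wave number `k`. -/
def opticMode (N k : ℕ) : Vec N :=
  normalize (rawMode N k (opticSymbol (k * Real.pi * mesh N)))

/-- The span of the acoustic modes with `kπh ≤ ηa` and the optic modes with `η₁ ≤ kπh ≤ η₂`,
`1 ≤ k ≤ N`. -/
def truncatedSpace (N : ℕ) (ηa η₁ η₂ : ℝ) : Submodule ℂ (Vec N) :=
  Submodule.span ℂ {F | ∃ k : ℕ, 1 ≤ k ∧ k ≤ N ∧ k * Real.pi * mesh N ≤ ηa ∧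
      F = acousticMode N k} ⊔
  Submodule.span ℂ {F | ∃ k : ℕ, 1 ≤ k ∧ k ≤ N ∧ η₁ ≤ k * Real.pi * mesh N ∧
      k * Real.pi * mesh N ≤ η₂ ∧ F = opticMode N k}

/-- The observed quantity `∫₀ᵀ ‖B_h U(t)‖² dt`. -/
def observation {N : ℕ} (T : ℝ) (U : ℝ → Vec N) : ℝ :=
  ∫ t in (0 : ℝ)..T, euclNormSq (act (observationMatrix N) (U t))

end P2Wave

end

/-! Expanded in eigenvectors, a solution oscillates at the frequencies `±λ(kπh)/h`, and the boundary
observation is the squared modulus of a nonharmonic Fourier sum in `t`. Ingham's inequalities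
(`ingham_inverse`, `ingham_direct`) compare the integral of such a squared modulus over `[0, T]`
with the sum of the squared coefficients, once the frequencies are `γ`-separated and, for the lower
bound, `T > 2π/γ`.

Separation: consecutive wave numbers are `πh` apart, so the mean value inequality gives gaps of at
least `π vᵃ` and `π vᵒ` inside the two branches. The acoustic bound also keeps the lowest frequency
away from `0`, which separates the two signs. Since `Λᵃ ≤ 10` and `Λᵒ ≥ 12`, the branches are at
least `(√12 - √10)/h` apart. For small `h` the gap is thus `γ = π min(vᵃ, vᵒ)`, and `2π/γ` is
exactly `T*`. For the finitely many larger `h` the gap may be smaller; there compactness and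
analyticity (`exists_expSum_lower_bound`) give a lower bound in any positive time.

Coefficients: up to the common amplitudes, a mode contributes `sin²(kπh)/h²` to the coefficient sum
and `‖φ‖² Λ/h²` to the energy. These are comparable on the truncated space
(`exists_modeSymbol_le_nodeValue`, `nodeValue_le_modeSymbol`): the cutoffs avoid the wave number
`π`, where the sine vanishes, and, for the optic branch, also `0`. At `0` the acoustic symbol
vanishes to the same order as the squared sine. -/

/-! ### Ingham's inequalities. -/

open Complex in
/-- The Fourier transform of a half period of the cosine. -/
lemma integral_cos_mul_cexp (a x : ℝ) (ha : 0 < a) (hx : x ^ 2 ≠ a ^ 2) :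
    ∫ t in -(Real.pi / (2 * a))..(Real.pi / (2 * a)),
      ((Real.cos (a * t) : ℝ) : ℂ) * exp (I * (x * t : ℝ)) =
    (a / (a ^ 2 - x ^ 2) : ℝ) * (exp (I * (x * (Real.pi / (2 * a)) : ℝ)) +
      exp (-(I * (x * (Real.pi / (2 * a)) : ℝ)))) := by
  have hne : ((a ^ 2 - x ^ 2 : ℝ) : ℂ) ≠ 0 := by
    exact_mod_cast sub_ne_zero.2 (Ne.symm hx)
  -- The primitive is found by integrating by parts twice.
  have hderiv : ∀ t ∈ Set.uIcc (-(Real.pi / (2 * a))) (Real.pi / (2 * a)),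
      HasDerivAt (fun t : ℝ => exp (I * (x * t : ℝ)) *
        (I * x * ((Real.cos (a * t) : ℝ) : ℂ) + a * ((Real.sin (a * t) : ℝ) : ℂ)) /
          ((a ^ 2 - x ^ 2 : ℝ) : ℂ))
        (((Real.cos (a * t) : ℝ) : ℂ) * exp (I * (x * t : ℝ))) t := by
    intro t _
    have hc : HasDerivAt (fun t : ℝ => ((Real.cos (a * t) : ℝ) : ℂ))
        ((-Real.sin (a * t) * (a * 1) : ℝ) : ℂ) t :=
      (((hasDerivAt_id t).const_mul a).cos).ofReal_comp
    have hs : HasDerivAt (fun t : ℝ => ((Real.sin (a * t) : ℝ) : ℂ))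
        ((Real.cos (a * t) * (a * 1) : ℝ) : ℂ) t :=
      (((hasDerivAt_id t).const_mul a).sin).ofReal_comp
    have he : HasDerivAt (fun t : ℝ => exp (I * (x * t : ℝ)))
        (exp (I * (x * t : ℝ)) * (I * ((x * 1 : ℝ) : ℂ))) t :=
      ((((hasDerivAt_id t).const_mul x).ofReal_comp).const_mul I).cexp
    have hsum : HasDerivAt (fun t : ℝ => I * x * ((Real.cos (a * t) : ℝ) : ℂ) +
        a * ((Real.sin (a * t) : ℝ) : ℂ)) (I * x * ((-Real.sin (a * t) * (a * 1) : ℝ) : ℂ) +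
        a * ((Real.cos (a * t) * (a * 1) : ℝ) : ℂ)) t :=
      (hc.const_mul (I * x)).add (hs.const_mul (a : ℂ))
    refine ((he.mul hsum).div_const _).congr_deriv ?_
    rw [div_eq_iff hne]
    push_cast
    linear_combination (exp (I * (↑x * ↑t)) * (x : ℂ) ^ 2 * Complex.cos (a * t)) * I_sq
  rw [intervalIntegral.integral_eq_sub_of_hasDerivAt hderiv
    (Continuous.intervalIntegrable (by fun_prop) _ _)]
  have h1 : a * (Real.pi / (2 * a)) = Real.pi / 2 := by field_simp
  have h2 : a * -(Real.pi / (2 * a)) = -(Real.pi / 2) := by field_simp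
  rw [h1, h2]
  simp only [Real.cos_neg, Real.sin_neg, Real.cos_pi_div_two, Real.sin_pi_div_two]
  push_cast at hne ⊢
  field_simp
  ring_nf

open Complex in
lemma norm_integral_cos_mul_cexp_le (a x : ℝ) (ha : 0 < a) (hx : a ^ 2 < x ^ 2) :
    ‖∫ t in -(Real.pi / (2 * a))..(Real.pi / (2 * a)),
      ((Real.cos (a * t) : ℝ) : ℂ) * exp (I * (x * t : ℝ))‖ ≤ 2 * a / (x ^ 2 - a ^ 2) := by
  rw [integral_cos_mul_cexp a x ha hx.ne', norm_mul, norm_real, Real.norm_eq_abs, abs_div,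
    abs_of_pos ha, abs_of_neg (by linarith), neg_sub]
  have h1 : ∀ y : ℝ, ‖exp (I * (y : ℂ))‖ = 1 := fun y => by
    rw [mul_comm]; exact norm_exp_ofReal_mul_I y
  have h2 := norm_add_le (exp (I * (x * (Real.pi / (2 * a)) : ℝ)))
    (exp (-(I * (x * (Real.pi / (2 * a)) : ℝ))))
  rw [h1, ← mul_neg, ← ofReal_neg, h1] at h2
  rw [← mul_neg, ← ofReal_neg]
  have h3 : 0 < a / (x ^ 2 - a ^ 2) := div_pos ha (by linarith)
  calc _ ≤ a / (x ^ 2 - a ^ 2) * (1 + 1) := by gcongr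
    _ = _ := by ring

/-- Telescoping: `1/(r² - 1/4) = 2/(2r - 1) - 2/(2r + 1)`. -/
lemma sum_Icc_inv_sq_sub_le (n : ℕ) :
    ∑ r ∈ Finset.Icc 1 n, 1 / ((r : ℝ) ^ 2 - 1 / 4) ≤ 2 - 2 / (2 * (n : ℝ) + 1) := by
  induction n with
  | zero => simp
  | succ n ih =>
    rw [Finset.sum_Icc_succ_top (by omega)]
    have h : (1 : ℝ) / (((n + 1 : ℕ) : ℝ) ^ 2 - 1 / 4) =
        2 / (2 * n + 1) - 2 / (2 * ((n + 1 : ℕ) : ℝ) + 1) := by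
      push_cast
      have h1 : (2 * (n : ℝ) + 1) ≠ 0 := by positivity
      have h2 : (2 * ((n : ℝ) + 1) + 1) ≠ 0 := by positivity
      have h3 : ((n : ℝ) + 1) ^ 2 - 1 / 4 = (2 * n + 1) * (2 * (n + 1) + 1) / 4 := by ring
      rw [h3]; field_simp; ring
    linarith

/-- One-sided summation over separated points. -/
lemma sum_separated_right_le {ι : Type*} (s : Finset ι) (x : ι → ℝ) {γ : ℝ} (hγ : 0 < γ)
    (h1 : ∀ j ∈ s, γ ≤ x j) (hsep : ∀ i ∈ s, ∀ j ∈ s, i ≠ j → γ ≤ |x i - x j|) :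
    ∑ j ∈ s, 1 / ((x j / γ) ^ 2 - 1 / 4) ≤ 2 := by
  classical
  -- Rounding `x j / γ` down is injective, as equal floors would put two points less than `γ` apart.
  -- It only increases the terms, and leaves a sum over distinct positive integers.
  have hr1 : ∀ j ∈ s, 1 ≤ ⌊x j / γ⌋₊ := fun j hj =>
    Nat.one_le_floor_iff _ |>.2 ((one_le_div hγ).2 (h1 j hj))
  have hinj : Set.InjOn (fun j => ⌊x j / γ⌋₊) s := by
    intro i hi j hj hij
    by_contra hne
    have hi' := Nat.floor_le (div_nonneg (hγ.le.trans (h1 i hi)) hγ.le)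
    have hj' := Nat.floor_le (div_nonneg (hγ.le.trans (h1 j hj)) hγ.le)
    have hi'' := Nat.lt_floor_add_one (x i / γ)
    have hj'' := Nat.lt_floor_add_one (x j / γ)
    simp only at hij
    rw [hij] at hi' hi''
    have h2 : |x i / γ - x j / γ| < 1 := abs_lt.2 ⟨by linarith, by linarith⟩
    rw [← sub_div, abs_div, abs_of_pos hγ, div_lt_one hγ] at h2
    exact absurd (hsep i hi j hj hne) (not_le.2 h2)
  calc _ ≤ ∑ j ∈ s, 1 / (((⌊x j / γ⌋₊ : ℕ) : ℝ) ^ 2 - 1 / 4) := by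
        refine Finset.sum_le_sum fun j hj => ?_
        have h2 : (1 : ℝ) ≤ ⌊x j / γ⌋₊ := by exact_mod_cast hr1 j hj
        have h3 := Nat.floor_le (div_nonneg (hγ.le.trans (h1 j hj)) hγ.le)
        apply one_div_le_one_div_of_le
        · nlinarith
        · gcongr
    _ = ∑ r ∈ s.image (fun j => ⌊x j / γ⌋₊), 1 / ((r : ℝ) ^ 2 - 1 / 4) := by
        rw [Finset.sum_image hinj]
    _ ≤ ∑ r ∈ Finset.Icc 1 ((s.image (fun j => ⌊x j / γ⌋₊)).sup id),
          1 / ((r : ℝ) ^ 2 - 1 / 4) := by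
        apply Finset.sum_le_sum_of_subset_of_nonneg
        · intro r hr
          refine Finset.mem_Icc.2 ⟨?_, Finset.le_sup (f := id) hr⟩
          obtain ⟨j, hj, rfl⟩ := Finset.mem_image.1 hr
          exact hr1 j hj
        · intro r hr _
          have : (1 : ℝ) ≤ r := by exact_mod_cast (Finset.mem_Icc.1 hr).1
          have : (0 : ℝ) ≤ (r : ℝ) ^ 2 - 1 / 4 := by nlinarith
          positivity
    _ ≤ 2 := (sum_Icc_inv_sq_sub_le _).trans (sub_le_self _ (by positivity))

/-- Since `a < γ/2`, replacing `a²` by `γ²/4` increases the terms; the points on either side of `μ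
i` then contribute at most `2 · 2a/γ²`. This constant is sharp enough for `2/a - 8a/γ²` to be
positive exactly when `a < γ/2`. -/
lemma sum_separated_kernel_le {ι : Type*} [DecidableEq ι] (s : Finset ι) (μ : ι → ℝ) {γ a : ℝ}
    (ha : 0 < a) (haγ : 2 * a < γ)
    (hsep : ∀ i ∈ s, ∀ j ∈ s, i ≠ j → γ ≤ |μ i - μ j|) (i : ι) (hi : i ∈ s) :
    ∑ j ∈ s.erase i, 2 * a / ((μ i - μ j) ^ 2 - a ^ 2) ≤ 8 * a / γ ^ 2 := by
  have hγ : 0 < γ := by linarith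
  have hterm : ∀ j ∈ s.erase i, 2 * a / ((μ i - μ j) ^ 2 - a ^ 2) ≤
      2 * a / γ ^ 2 * (1 / (((μ i - μ j) / γ) ^ 2 - 1 / 4)) := by
    intro j hj
    have h1 := hsep i hi j (Finset.mem_of_mem_erase hj) (Finset.ne_of_mem_erase hj).symm
    have h2 : γ ^ 2 ≤ (μ i - μ j) ^ 2 := by
      rw [← sq_abs (μ i - μ j)]; gcongr
    have h3 : ((μ i - μ j) / γ) ^ 2 - 1 / 4 = ((μ i - μ j) ^ 2 - γ ^ 2 / 4) / γ ^ 2 := by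
      field_simp
    rw [h3, one_div_div]
    have h4 : 2 * a / γ ^ 2 * (γ ^ 2 / ((μ i - μ j) ^ 2 - γ ^ 2 / 4)) =
        2 * a / ((μ i - μ j) ^ 2 - γ ^ 2 / 4) := by
      field_simp
    rw [h4]
    have : 0 < (μ i - μ j) ^ 2 - γ ^ 2 / 4 := by nlinarith
    apply div_le_div_of_nonneg_left (by linarith) this
    nlinarith
  refine (Finset.sum_le_sum hterm).trans ?_
  rw [← Finset.mul_sum, ← Finset.sum_filter_add_sum_filter_not _ (fun j => μ i ≤ μ j)]
  have hA : ∑ j ∈ (s.erase i).filter (fun j => μ i ≤ μ j),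
      1 / (((μ i - μ j) / γ) ^ 2 - 1 / 4) ≤ 2 := by
    have := sum_separated_right_le ((s.erase i).filter (fun j => μ i ≤ μ j))
      (fun j => μ j - μ i) hγ ?_ ?_
    · refine le_of_eq_of_le (Finset.sum_congr rfl fun j _ => ?_) this
      rw [div_pow, div_pow, ← neg_sub (μ j), neg_sq]
    · intro j hj
      simp only [Finset.mem_filter, Finset.mem_erase] at hj
      have := hsep j hj.1.2 i hi hj.1.1
      rwa [abs_of_nonneg (by linarith)] at this
    · intro j hj k hk hjk
      simp only [Finset.mem_filter, Finset.mem_erase] at hj hk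
      rw [sub_sub_sub_cancel_right]
      exact hsep j hj.1.2 k hk.1.2 hjk
  have hB : ∑ j ∈ (s.erase i).filter (fun j => ¬ μ i ≤ μ j),
      1 / (((μ i - μ j) / γ) ^ 2 - 1 / 4) ≤ 2 := by
    apply sum_separated_right_le ((s.erase i).filter (fun j => ¬ μ i ≤ μ j))
      (fun j => μ i - μ j) hγ
    · intro j hj
      simp only [Finset.mem_filter, Finset.mem_erase] at hj
      have := hsep i hi j hj.1.2 hj.1.1.symm
      rwa [abs_of_nonneg (by linarith)] at this
    · intro j hj k hk hjk
      simp only [Finset.mem_filter, Finset.mem_erase] at hj hk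
      rw [sub_sub_sub_cancel_left]
      exact hsep k hk.1.2 j hj.1.2 hjk.symm
  calc _ ≤ 2 * a / γ ^ 2 * (2 + 2) := by gcongr
    _ = _ := by ring

/-- A nonharmonic trigonometric sum. -/
noncomputable def expSum {ι : Type*} (s : Finset ι) (μ : ι → ℝ) (c : ι → ℂ) (t : ℝ) : ℂ :=
  ∑ i ∈ s, c i * Complex.exp (Complex.I * (μ i * t : ℝ))

lemma continuous_expSum {ι : Type*} (s : Finset ι) (μ : ι → ℝ) (c : ι → ℂ) :
    Continuous (expSum s μ c) := by
  unfold expSum; fun_prop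

open Complex in
lemma norm_sq_expSum {ι : Type*} (s : Finset ι) (μ : ι → ℝ) (c : ι → ℂ) (t : ℝ) :
    ((‖expSum s μ c t‖ ^ 2 : ℝ) : ℂ) = ∑ i ∈ s, ∑ j ∈ s,
      c i * (starRingEnd ℂ) (c j) * exp (I * ((μ i - μ j) * t : ℝ)) := by
  rw [← normSq_eq_norm_sq, ← mul_conj, expSum, map_sum, Finset.sum_mul_sum]
  refine Finset.sum_congr rfl fun i _ => Finset.sum_congr rfl fun j _ => ?_
  rw [map_mul, ← exp_conj, map_mul, conj_I, conj_ofReal, mul_mul_mul_comm, ← exp_add]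
  congr 2
  push_cast; ring

/-- Schur's test for a symmetric off-diagonal kernel. -/
lemma norm_sum_offDiag_le {ι : Type*} [DecidableEq ι] (s : Finset ι) (c : ι → ℂ)
    (K : ι → ι → ℂ) (k : ι → ι → ℝ) (R : ι → ℝ) (hsymm : ∀ i j, k i j = k j i)
    (hK : ∀ i ∈ s, ∀ j ∈ s.erase i, ‖K i j‖ ≤ k i j)
    (hR : ∀ i ∈ s, ∑ j ∈ s.erase i, k i j ≤ R i) :
    ‖∑ i ∈ s, ∑ j ∈ s.erase i, c i * (starRingEnd ℂ) (c j) * K i j‖ ≤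
      ∑ i ∈ s, R i * ‖c i‖ ^ 2 := by
  have hswap : ∑ i ∈ s, ∑ j ∈ s.erase i, ‖c j‖ ^ 2 * k i j =
      ∑ i ∈ s, ∑ j ∈ s.erase i, ‖c i‖ ^ 2 * k i j := by
    rw [Finset.sum_comm' (t' := s) (s' := fun j => s.erase j)]
    · exact Finset.sum_congr rfl fun i _ => Finset.sum_congr rfl fun j _ => by rw [hsymm]
    · intro i j; simp only [Finset.mem_erase]; tauto
  calc _ ≤ ∑ i ∈ s, ∑ j ∈ s.erase i,
        (1 / 2 * (‖c i‖ ^ 2 * k i j) + 1 / 2 * (‖c j‖ ^ 2 * k i j)) := by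
        refine norm_sum_le_of_le _ fun i hi => norm_sum_le_of_le _ fun j hj => ?_
        rw [norm_mul, norm_mul, RCLike.norm_conj]
        have h1 := hK i hi j hj
        have h3 : ‖c i‖ * ‖c j‖ ≤ 1 / 2 * (‖c i‖ ^ 2 + ‖c j‖ ^ 2) := by
          nlinarith [sq_nonneg (‖c i‖ - ‖c j‖)]
        calc _ ≤ 1 / 2 * (‖c i‖ ^ 2 + ‖c j‖ ^ 2) * k i j := by gcongr
          _ = _ := by ring
    _ = ∑ i ∈ s, ∑ j ∈ s.erase i, ‖c i‖ ^ 2 * k i j := by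
        simp_rw [Finset.sum_add_distrib, ← Finset.mul_sum]
        simp_rw [← Finset.mul_sum] at hswap
        rw [hswap]
        ring
    _ ≤ _ := by
        refine Finset.sum_le_sum fun i hi => ?_
        rw [← Finset.mul_sum, mul_comm (R i)]
        gcongr
        exact hR i hi

open Complex in
/-- The kernel form of Ingham's inequalities. -/
lemma abs_integral_cos_mul_expSum_sub_le {ι : Type*} (s : Finset ι) (μ : ι → ℝ) (c : ι → ℂ)
    {γ a : ℝ} (ha : 0 < a) (haγ : 2 * a < γ)
    (hsep : ∀ i ∈ s, ∀ j ∈ s, i ≠ j → γ ≤ |μ i - μ j|) :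
    |(∫ t in -(Real.pi / (2 * a))..(Real.pi / (2 * a)),
      Real.cos (a * t) * ‖expSum s μ c t‖ ^ 2) - 2 / a * ∑ i ∈ s, ‖c i‖ ^ 2| ≤
      8 * a / γ ^ 2 * ∑ i ∈ s, ‖c i‖ ^ 2 := by
  classical
  have hγ : 0 < γ := by linarith
  set K : ℝ → ℂ := fun x => ∫ t in -(Real.pi / (2 * a))..(Real.pi / (2 * a)),
      ((Real.cos (a * t) : ℝ) : ℂ) * exp (I * (x * t : ℝ)) with hK
  have hK0 : K 0 = ((2 / a : ℝ) : ℂ) := by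
    rw [hK]; simp only
    rw [integral_cos_mul_cexp a 0 ha (by simpa using (pow_pos ha 2).ne)]
    have : (a : ℂ) ≠ 0 := by exact_mod_cast ha.ne'
    simp
    field_simp
    norm_num
  have hmain : ((∫ t in -(Real.pi / (2 * a))..(Real.pi / (2 * a)),
      Real.cos (a * t) * ‖expSum s μ c t‖ ^ 2 : ℝ) : ℂ) =
      ∑ i ∈ s, ∑ j ∈ s, c i * (starRingEnd ℂ) (c j) * K (μ i - μ j) := by
    rw [← intervalIntegral.integral_ofReal]
    have : ∀ t : ℝ, ((Real.cos (a * t) * ‖expSum s μ c t‖ ^ 2 : ℝ) : ℂ) =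
        ∑ i ∈ s, ∑ j ∈ s, c i * (starRingEnd ℂ) (c j) *
          (((Real.cos (a * t) : ℝ) : ℂ) * exp (I * ((μ i - μ j) * t : ℝ))) := by
      intro t
      rw [ofReal_mul, norm_sq_expSum, Finset.mul_sum]
      refine Finset.sum_congr rfl fun i _ => ?_
      rw [Finset.mul_sum]
      exact Finset.sum_congr rfl fun j _ => by ring
    simp_rw [this]
    rw [intervalIntegral.integral_finsetSum
      fun i _ => Continuous.intervalIntegrable (by fun_prop) _ _]
    refine Finset.sum_congr rfl fun i _ => ?_
    rw [intervalIntegral.integral_finsetSum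
      fun i _ => Continuous.intervalIntegrable (by fun_prop) _ _]
    exact Finset.sum_congr rfl fun j _ => intervalIntegral.integral_const_mul _ _
  -- The diagonal terms carry `K 0 = 2/a` and cancel the subtracted main term, so only the
  -- off-diagonal part remains for Schur's test.
  have hsplit : (((∫ t in -(Real.pi / (2 * a))..(Real.pi / (2 * a)),
      Real.cos (a * t) * ‖expSum s μ c t‖ ^ 2) - 2 / a * ∑ i ∈ s, ‖c i‖ ^ 2 : ℝ) : ℂ) =
      ∑ i ∈ s, ∑ j ∈ s.erase i, c i * (starRingEnd ℂ) (c j) * K (μ i - μ j) := by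
    rw [ofReal_sub, hmain, ofReal_mul, ofReal_sum, Finset.mul_sum, ← Finset.sum_sub_distrib]
    refine Finset.sum_congr rfl fun i hi => ?_
    rw [← Finset.add_sum_erase s _ hi, sub_self, hK0, mul_conj, normSq_eq_norm_sq]
    push_cast; ring
  have hKle : ∀ i ∈ s, ∀ j ∈ s.erase i, ‖K (μ i - μ j)‖ ≤ 2 * a / ((μ i - μ j) ^ 2 - a ^ 2) := by
    intro i hi j hj
    apply norm_integral_cos_mul_cexp_le a _ ha
    have h1 := hsep i hi j (Finset.mem_of_mem_erase hj) (Finset.ne_of_mem_erase hj).symm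
    have h2 : γ ^ 2 ≤ (μ i - μ j) ^ 2 := by
      rw [← sq_abs (μ i - μ j)]; gcongr
    nlinarith
  rw [← Real.norm_eq_abs, ← norm_real, hsplit, Finset.mul_sum]
  refine norm_sum_offDiag_le s c _ _ _ (fun i j => ?_) hKle
    (sum_separated_kernel_le s μ ha haγ hsep)
  rw [← neg_sub (μ i), neg_sq]

/-- Translating the time changes the coefficients by phases. -/
lemma expSum_add {ι : Type*} (s : Finset ι) (μ : ι → ℝ) (c : ι → ℂ) (t τ : ℝ) :
    expSum s μ c (t + τ) =
      expSum s μ (fun i => c i * Complex.exp (Complex.I * (μ i * τ : ℝ))) t := by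
  refine Finset.sum_congr rfl fun i _ => ?_
  rw [mul_assoc, ← Complex.exp_add]
  congr 2
  push_cast; ring

lemma norm_mul_cexp_I (c : ℂ) (y : ℝ) : ‖c * Complex.exp (Complex.I * (y : ℂ))‖ = ‖c‖ := by
  rw [norm_mul, mul_comm Complex.I, Complex.norm_exp_ofReal_mul_I, mul_one]

/-- The cosine kernel lives on an interval centred at `0`. Centring `[0, T]` changes the
coefficients by phases only, hence not their moduli. -/
lemma integral_expSum_shift {ι : Type*} (s : Finset ι) (μ : ι → ℝ) (c : ι → ℂ) (T : ℝ) :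
    ∫ t in (0 : ℝ)..T, ‖expSum s μ c t‖ ^ 2 = ∫ t in -(T / 2)..T / 2,
      ‖expSum s μ (fun i => c i * Complex.exp (Complex.I * (μ i * (T / 2) : ℝ))) t‖ ^ 2 := by
  simp_rw [← expSum_add]
  rw [intervalIntegral.integral_comp_add_right (fun t => ‖expSum s μ c t‖ ^ 2) (T / 2)]
  congr 1 <;> ring

/-- Ingham's inverse inequality. -/
lemma ingham_inverse {ι : Type*} (s : Finset ι) (μ : ι → ℝ) (c : ι → ℂ) {γ T : ℝ} (hγ : 0 < γ)
    (hT : 2 * Real.pi / γ < T) (hsep : ∀ i ∈ s, ∀ j ∈ s, i ≠ j → γ ≤ |μ i - μ j|) :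
    (2 * T / Real.pi - 8 * Real.pi / (γ ^ 2 * T)) * ∑ i ∈ s, ‖c i‖ ^ 2 ≤
      ∫ t in (0 : ℝ)..T, ‖expSum s μ c t‖ ^ 2 := by
  have hπ := Real.pi_pos
  have hT0 : 0 < T := lt_trans (by positivity) hT
  -- With `a = π/T` the half period of the cosine is exactly `[-T/2, T/2]`, and `2a < γ` becomes `T
  -- > 2π/γ`.
  have ha : 0 < Real.pi / T := by positivity
  have haγ : 2 * (Real.pi / T) < γ := by
    rw [div_lt_iff₀ hγ] at hT
    rw [← mul_div_assoc, div_lt_iff₀ hT0]; linarith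
  have h := abs_integral_cos_mul_expSum_sub_le s μ
    (fun i => c i * Complex.exp (Complex.I * (μ i * (T / 2) : ℝ))) ha haγ hsep
  have e1 : Real.pi / (2 * (Real.pi / T)) = T / 2 := by field_simp
  have e2 : 2 / (Real.pi / T) = 2 * T / Real.pi := by field_simp
  have e3 : 8 * (Real.pi / T) / γ ^ 2 = 8 * Real.pi / (γ ^ 2 * T) := by field_simp
  rw [e1, e2, e3] at h
  simp_rw [norm_mul_cexp_I] at h
  rw [integral_expSum_shift]
  have hle : (∫ t in -(T / 2)..T / 2, Real.cos (Real.pi / T * t) *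
      ‖expSum s μ (fun i => c i * Complex.exp (Complex.I * (μ i * (T / 2) : ℝ))) t‖ ^ 2) ≤
      ∫ t in -(T / 2)..T / 2,
      ‖expSum s μ (fun i => c i * Complex.exp (Complex.I * (μ i * (T / 2) : ℝ))) t‖ ^ 2 := by
    have hc := continuous_expSum s μ
      (fun i => c i * Complex.exp (Complex.I * (μ i * (T / 2) : ℝ)))
    refine intervalIntegral.integral_mono_on (by linarith)
      (Continuous.intervalIntegrable (by fun_prop) _ _)
      (Continuous.intervalIntegrable (by fun_prop) _ _) fun t _ => ?_
    exact mul_le_of_le_one_left (by positivity) (Real.cos_le_one _)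
  have := (abs_le.1 h).1
  rw [sub_mul]
  linarith

lemma ingham_inverse_const_pos {γ T : ℝ} (hγ : 0 < γ) (hT : 2 * Real.pi / γ < T) :
    0 < 2 * T / Real.pi - 8 * Real.pi / (γ ^ 2 * T) := by
  have hπ := Real.pi_pos
  have hT0 : 0 < T := lt_trans (by positivity) hT
  rw [div_lt_iff₀ hγ] at hT
  rw [sub_pos, div_lt_div_iff₀ (by positivity) hπ]
  nlinarith

/-- Ingham's direct inequality. -/
lemma ingham_direct {γ T : ℝ} (hγ : 0 < γ) (hT : 0 < T) : ∃ C : ℝ, 0 < C ∧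
    ∀ {ι : Type} (s : Finset ι) (μ : ι → ℝ) (c : ι → ℂ),
      (∀ i ∈ s, ∀ j ∈ s, i ≠ j → γ ≤ |μ i - μ j|) →
      ∫ t in (0 : ℝ)..T, ‖expSum s μ c t‖ ^ 2 ≤ C * ∑ i ∈ s, ‖c i‖ ^ 2 := by
  have hπ := Real.pi_pos
  -- The first bound gives `2a < γ`. The second gives `|at| ≤ π/6` on `[-T/2, T/2]`, where the
  -- cosine is at least `1/2`; this is why no lower bound on `T` is needed.
  set a : ℝ := min (γ / 4) (Real.pi / (3 * T)) with ha_def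
  have ha : 0 < a := by positivity
  have haγ : 2 * a < γ := by linarith [min_le_left (γ / 4) (Real.pi / (3 * T))]
  have haT : a * T ≤ Real.pi / 3 := by
    calc a * T ≤ Real.pi / (3 * T) * T := by gcongr; exact min_le_right _ _
      _ = _ := by field_simp
  refine ⟨2 * (2 / a + 8 * a / γ ^ 2), by positivity, fun {ι} s μ c hsep => ?_⟩
  have h := abs_integral_cos_mul_expSum_sub_le s μ
    (fun i => c i * Complex.exp (Complex.I * (μ i * (T / 2) : ℝ))) ha haγ hsep
  simp_rw [norm_mul_cexp_I] at h
  rw [integral_expSum_shift]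
  set f := expSum s μ (fun i => c i * Complex.exp (Complex.I * (μ i * (T / 2) : ℝ))) with hf
  have hc : Continuous f := continuous_expSum _ _ _
  have hTb : T / 2 ≤ Real.pi / (2 * a) := by
    rw [div_le_div_iff₀ (by norm_num) (by positivity)]; nlinarith
  have h1 : ∫ t in -(T / 2)..T / 2, ‖f t‖ ^ 2 ≤
      ∫ t in -(T / 2)..T / 2, 2 * (Real.cos (a * t) * ‖f t‖ ^ 2) := by
    refine intervalIntegral.integral_mono_on (by linarith)
      (Continuous.intervalIntegrable (by fun_prop) _ _)
      (Continuous.intervalIntegrable (by fun_prop) _ _) fun t ht => ?_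
    have h2 : 1 / 2 ≤ Real.cos (a * t) := by
      rw [← Real.cos_pi_div_three, ← Real.cos_abs (a * t)]
      apply Real.cos_le_cos_of_nonneg_of_le_pi (abs_nonneg _) (by linarith)
      rw [abs_mul, abs_of_pos ha]
      have : |t| ≤ T / 2 := abs_le.2 ht
      nlinarith
    nlinarith [sq_nonneg ‖f t‖]
  have h2 : ∫ t in -(T / 2)..T / 2, Real.cos (a * t) * ‖f t‖ ^ 2 ≤
      ∫ t in -(Real.pi / (2 * a))..(Real.pi / (2 * a)), Real.cos (a * t) * ‖f t‖ ^ 2 := by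
    refine intervalIntegral.integral_mono_interval (by linarith) (by linarith) hTb ?_
      (Continuous.intervalIntegrable (by fun_prop) _ _)
    refine (MeasureTheory.ae_restrict_mem measurableSet_Ioc).mono fun t ht => ?_
    refine mul_nonneg (Real.cos_nonneg_of_mem_Icc ?_) (by positivity)
    have e : a * (Real.pi / (2 * a)) = Real.pi / 2 := by field_simp
    constructor
    · nlinarith [ht.1]
    · nlinarith [ht.2]
  rw [intervalIntegral.integral_const_mul] at h1
  have := (abs_le.1 h).2
  nlinarith

/-! ### Finite families of distinct frequencies. -/

lemma exists_pos_separation {ι : Type*} (s : Finset ι) (μ : ι → ℝ) (hμ : Set.InjOn μ s) :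
    ∃ γ : ℝ, 0 < γ ∧ ∀ i ∈ s, ∀ j ∈ s, i ≠ j → γ ≤ |μ i - μ j| := by
  classical
  rcases s.offDiag.eq_empty_or_nonempty with h | h
  · refine ⟨1, one_pos, fun i hi j hj hij => ?_⟩
    have : (i, j) ∈ s.offDiag := Finset.mem_offDiag.2 ⟨hi, hj, hij⟩
    simp [h] at this
  · obtain ⟨p, hp, hmin⟩ := Finset.exists_min_image _ (fun p => |μ p.1 - μ p.2|) h
    obtain ⟨h1, h2, h3⟩ := Finset.mem_offDiag.1 hp
    exact ⟨|μ p.1 - μ p.2|, abs_pos.2 (sub_ne_zero.2 fun h => h3 (hμ h1 h2 h)),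
      fun i hi j hj hij => hmin (i, j) (Finset.mem_offDiag.2 ⟨hi, hj, hij⟩)⟩

/-- The sum is real analytic in `t`, so its vanishing near `T/2` spreads to the whole line. -/
lemma expSum_eq_zero_of_eqOn {ι : Type*} (s : Finset ι) (μ : ι → ℝ) (c : ι → ℂ) {T : ℝ}
    (hT : 0 < T) (h : ∀ t ∈ Set.Icc 0 T, expSum s μ c t = 0) (t : ℝ) : expSum s μ c t = 0 := by
  have ha : AnalyticOnNhd ℝ (expSum s μ c) Set.univ := by
    intro x _
    unfold expSum
    refine Finset.analyticAt_fun_sum _ fun i _ => analyticAt_const.mul ?_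
    have h1 : AnalyticAt ℝ (fun t : ℝ => Complex.I * ((μ i * t : ℝ) : ℂ)) x :=
      analyticAt_const.mul
        ((Complex.ofRealCLM.analyticAt _).comp (analyticAt_const.mul analyticAt_id))
    exact (analyticAt_cexp.restrictScalars (𝕜 := ℝ)).comp h1
  have h0 : expSum s μ c =ᶠ[nhds (T / 2)] 0 := by
    filter_upwards [Icc_mem_nhds (show 0 < T / 2 by linarith) (show T / 2 < T by linarith)]
      with t ht using h t ht
  exact ha.eqOn_zero_of_preconnected_of_eventuallyEq_zero isPreconnected_univ
    (Set.mem_univ _) h0 (Set.mem_univ t)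

/-- A finite family of distinct frequencies is observable in any positive time. -/
lemma exists_expSum_lower_bound {ι : Type*} (s : Finset ι) (μ : ι → ℝ)
    (hμ : Set.InjOn μ s) {T : ℝ} (hT : 0 < T) : ∃ C : ℝ, 0 < C ∧ ∀ c : ι → ℂ,
      C * ∑ i ∈ s, ‖c i‖ ^ 2 ≤ ∫ t in (0 : ℝ)..T, ‖expSum s μ c t‖ ^ 2 := by
  classical
  rcases s.eq_empty_or_nonempty with rfl | hs
  · exact ⟨1, one_pos, fun c => by simp [expSum]⟩
  obtain ⟨γ, hγ, hsep⟩ := exists_pos_separation s μ hμ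
  let ν : s → ℝ := fun i => μ i
  have hred : ∀ c : ι → ℂ, ∀ t, expSum s μ c t = expSum Finset.univ ν (fun i : s => c i) t :=
    fun c t => (Finset.sum_coe_sort s fun i => c i * Complex.exp (Complex.I * (μ i * t : ℝ))).symm
  let q : EuclideanSpace ℂ s → ℝ := fun c =>
    ∫ t in (0 : ℝ)..T, ‖expSum Finset.univ ν c t‖ ^ 2
  have hq : Continuous q := by
    apply intervalIntegral.continuous_parametric_intervalIntegral_of_continuous'
    simp only [Function.uncurry_def, expSum]
    fun_prop
  have hne : (Metric.sphere (0 : EuclideanSpace ℂ s) 1).Nonempty := by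
    obtain ⟨i, hi⟩ := hs
    exact ⟨EuclideanSpace.single ⟨i, hi⟩ 1, by simp⟩
  -- The constant is the minimum of the quadratic form `q` on the unit sphere; general coefficients
  -- follow by homogeneity.
  obtain ⟨e, he, hmin⟩ := (isCompact_sphere (0 : EuclideanSpace ℂ s) 1).exists_isMinOn hne
    hq.continuousOn
  have hpos : 0 < q e := by
    apply intervalIntegral.integral_pos hT
    · exact ((continuous_expSum _ _ _).norm.pow 2).continuousOn
    · intro t _; positivity
    · by_contra! hcon
      have h0 : ∀ t ∈ Set.Icc 0 T, expSum Finset.univ ν e t = 0 := fun t ht => by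
        have := hcon t ht
        have h2 : ‖expSum Finset.univ ν e t‖ ^ 2 = 0 := le_antisymm this (by positivity)
        simpa using h2
      have h1 := expSum_eq_zero_of_eqOn _ _ _ hT h0
      -- The sum now vanishes for all times, so Ingham's inequality may be applied on any interval
      -- longer than `2π/γ`; it contradicts `‖e‖ = 1`.
      have hT' : 2 * Real.pi / γ < 2 * Real.pi / γ + 1 := by linarith
      have h2 := ingham_inverse Finset.univ ν e hγ hT'
        (fun i _ j _ hij => hsep i i.2 j j.2 fun h => hij (Subtype.ext h))
      have h3 := ingham_inverse_const_pos hγ hT'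
      simp only [h1] at h2
      have h4 : ∑ i, ‖e i‖ ^ 2 = 1 := by
        rw [← EuclideanSpace.norm_sq_eq, mem_sphere_zero_iff_norm.1 he, one_pow]
      rw [h4] at h2
      norm_num at h2
      linarith
  refine ⟨q e, hpos, fun c => ?_⟩
  simp_rw [hred c]
  rw [← Finset.sum_coe_sort s]
  set d : EuclideanSpace ℂ s := WithLp.toLp 2 (fun i : s => c i) with hd
  have hd2 : ∑ i : s, ‖c i‖ ^ 2 = ‖d‖ ^ 2 := by rw [EuclideanSpace.norm_sq_eq]
  rw [hd2]
  change q e * ‖d‖ ^ 2 ≤ q d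
  rcases eq_or_ne d 0 with h0 | h0
  · rw [h0, norm_zero]
    simp only [ne_eq, OfNat.ofNat_ne_zero, not_false_eq_true, zero_pow, mul_zero]
    exact intervalIntegral.integral_nonneg hT.le fun t _ => by positivity
  · have hn : 0 < ‖d‖ := norm_pos_iff.2 h0
    have h1 := hmin (show ((‖d‖⁻¹ : ℝ) : ℂ) • d ∈ Metric.sphere (0 : EuclideanSpace ℂ s) 1 by
      rw [mem_sphere_zero_iff_norm, norm_smul, Complex.norm_real, norm_inv, norm_norm,
        inv_mul_cancel₀ hn.ne'])
    have h2 : q (((‖d‖⁻¹ : ℝ) : ℂ) • d) = (‖d‖ ^ 2)⁻¹ * q d := by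
      change ∫ t in (0 : ℝ)..T, _ = _ * ∫ t in (0 : ℝ)..T, _
      rw [← intervalIntegral.integral_const_mul]
      refine intervalIntegral.integral_congr fun t _ => ?_
      have : expSum Finset.univ ν (((‖d‖⁻¹ : ℝ) : ℂ) • d).ofLp t =
          ((‖d‖⁻¹ : ℝ) : ℂ) * expSum Finset.univ ν d.ofLp t := by
        simp only [expSum, Finset.mul_sum]
        refine Finset.sum_congr rfl fun i _ => ?_
        simp [mul_assoc]
      simp only
      rw [this, norm_mul, Complex.norm_real, norm_inv, norm_norm, mul_pow, inv_pow]
    simp only [Set.mem_ofPred_eq] at h1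
    rw [h2, ← div_eq_inv_mul, le_div_iff₀ (by positivity)] at h1
    exact h1

/-! ### The dispersion relations and their group velocities. -/

namespace P2Wave

lemma one_le_discr (η : ℝ) : 1 ≤ discr η := by
  unfold discr
  nlinarith [sq_nonneg (Real.cos (η / 2)), Real.cos_sq_le_one (η / 2)]

lemma sqrt_discr_pos (η : ℝ) : 0 < Real.sqrt (discr η) :=
  Real.sqrt_pos.2 (one_pos.trans_le (one_le_discr η))

lemma one_le_sqrt_discr (η : ℝ) : 1 ≤ Real.sqrt (discr η) := by
  rw [Real.one_le_sqrt]; exact one_le_discr η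

lemma sqrt_discr_le (η : ℝ) : Real.sqrt (discr η) ≤ 15 := by
  rw [Real.sqrt_le_left (by norm_num)]
  unfold discr
  nlinarith [sq_nonneg (Real.cos (η / 2)), Real.cos_sq_le_one (η / 2)]

/-- Minus the derivative of `4 cos² + √Δ`, divided by `sin cos`. -/
noncomputable def symbolSlope (η : ℝ) : ℝ := 4 + (134 - 44 * Real.cos (η / 2) ^ 2) / Real.sqrt (discr η)

lemma symbolSlope_pos (η : ℝ) : 0 < symbolSlope η := by
  have h1 := sqrt_discr_pos η
  have h2 : 0 < 134 - 44 * Real.cos (η / 2) ^ 2 := by nlinarith [Real.cos_sq_le_one (η / 2)]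
  unfold symbolSlope
  positivity

lemma continuous_sqrt_discr : Continuous fun η => Real.sqrt (discr η) := by
  unfold discr; fun_prop

lemma continuous_symbolSlope : Continuous symbolSlope := by
  have := continuous_sqrt_discr
  unfold symbolSlope
  exact continuous_const.add (Continuous.div (by fun_prop) this fun η => (sqrt_discr_pos η).ne')

lemma hasDerivAt_cos_half (η : ℝ) :
    HasDerivAt (fun η : ℝ => Real.cos (η / 2)) (-Real.sin (η / 2) * (1 / 2)) η :=
  ((hasDerivAt_id η).div_const 2).cos

lemma hasDerivAt_sin_half (η : ℝ) :
    HasDerivAt (fun η : ℝ => Real.sin (η / 2)) (Real.cos (η / 2) * (1 / 2)) η :=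
  ((hasDerivAt_id η).div_const 2).sin

lemma hasDerivAt_cos_sq_add_sqrt_discr (η : ℝ) :
    HasDerivAt (fun η => 4 * Real.cos (η / 2) ^ 2 + Real.sqrt (discr η))
      (-(Real.cos (η / 2) * Real.sin (η / 2) * symbolSlope η)) η := by
  have hc := hasDerivAt_cos_half η
  have hd : HasDerivAt discr (268 * (2 * Real.cos (η / 2) ^ 1 * (-Real.sin (η / 2) * (1 / 2))) -
      44 * (4 * Real.cos (η / 2) ^ 3 * (-Real.sin (η / 2) * (1 / 2)))) η :=
    (((hc.pow 2).const_mul 268).const_add 1).sub ((hc.pow 4).const_mul 44)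
  have h1 := sqrt_discr_pos η
  have hs := hd.sqrt (by linarith [one_le_discr η])
  refine (((hc.pow 2).const_mul 4).add hs).congr_deriv ?_
  unfold symbolSlope
  field_simp
  norm_num
  ring

/-- The denominator of the acoustic symbol. -/
noncomputable def acousticDen (η : ℝ) : ℝ := 11 + 4 * Real.cos (η / 2) ^ 2 + Real.sqrt (discr η)

lemma acousticDen_ge (η : ℝ) : 12 ≤ acousticDen η := by
  unfold acousticDen
  nlinarith [sq_nonneg (Real.cos (η / 2)), one_le_sqrt_discr η]

lemma acousticDen_le (η : ℝ) : acousticDen η ≤ 30 := by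
  unfold acousticDen
  nlinarith [Real.cos_sq_le_one (η / 2), sqrt_discr_le η]

lemma continuous_acousticDen : Continuous acousticDen := by
  have := continuous_sqrt_discr
  unfold acousticDen; fun_prop

lemma acousticSymbol_mul_den (η : ℝ) :
    acousticSymbol η * acousticDen η = 120 * Real.sin (η / 2) ^ 2 :=
  div_mul_cancel₀ _ (by have := acousticDen_ge η; unfold acousticDen at this; linarith)

lemma hasDerivAt_acousticDen (η : ℝ) : HasDerivAt acousticDen
    (-(Real.cos (η / 2) * Real.sin (η / 2) * symbolSlope η)) η := by
  have h := (hasDerivAt_cos_sq_add_sqrt_discr η).const_add 11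
  have e : acousticDen = fun η => 11 + (4 * Real.cos (η / 2) ^ 2 + Real.sqrt (discr η)) := by
    funext η; unfold acousticDen; ring
  rw [e]; exact h

/-- The derivative of the acoustic dispersion relation. -/
noncomputable def acousticSpeed (η : ℝ) : ℝ :=
  Real.cos (η / 2) * (Real.sqrt (120 / acousticDen η) / 2 + Real.sin (η / 2) ^ 2 *
    (120 * symbolSlope η / acousticDen η ^ 2) / (2 * Real.sqrt (120 / acousticDen η)))

/-- On `[0, π]` the sine is nonnegative, so the root of its square can be taken out. The remaining
product is smooth up to the endpoints and yields the one-sided derivative at the corner `0`. -/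
lemma acousticDispersion_eq {η : ℝ} (hη : η ∈ Set.Icc 0 Real.pi) :
    acousticDispersion η = Real.sin (η / 2) * Real.sqrt (120 / acousticDen η) := by
  have hs : 0 ≤ Real.sin (η / 2) :=
    Real.sin_nonneg_of_nonneg_of_le_pi (by linarith [hη.1]) (by linarith [hη.1, hη.2])
  have e : acousticSymbol η = Real.sin (η / 2) ^ 2 * (120 / acousticDen η) := by
    unfold acousticSymbol acousticDen; ring
  rw [acousticDispersion, e, Real.sqrt_mul (by positivity), Real.sqrt_sq hs]

lemma sqrt_acoustic_pos (η : ℝ) : 0 < Real.sqrt (120 / acousticDen η) :=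
  Real.sqrt_pos.2 (div_pos (by norm_num) (by linarith [acousticDen_ge η]))

lemma hasDerivWithinAt_acousticDispersion {η : ℝ} (hη : η ∈ Set.Icc 0 Real.pi) :
    HasDerivWithinAt acousticDispersion (acousticSpeed η) (Set.Icc 0 Real.pi) η := by
  have hD : 0 < acousticDen η := by linarith [acousticDen_ge η]
  have hR := sqrt_acoustic_pos η
  have h1 := ((hasDerivAt_acousticDen η).fun_inv hD.ne').const_mul 120
  have h2 := h1.sqrt (by positivity)
  have h3 := (hasDerivAt_sin_half η).mul h2
  refine (h3.hasDerivWithinAt.congr (fun x hx => ?_) ?_).congr_deriv ?_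
  · simp only [acousticDispersion_eq hx, div_eq_mul_inv, Pi.mul_apply]
  · simp only [acousticDispersion_eq hη, div_eq_mul_inv, Pi.mul_apply]
  · unfold acousticSpeed
    rw [← div_eq_mul_inv]
    field_simp

lemma continuous_acousticSpeed : Continuous acousticSpeed := by
  have h1 := continuous_acousticDen
  have h2 := continuous_symbolSlope
  have h3 : ∀ η, acousticDen η ≠ 0 := fun η => by linarith [acousticDen_ge η]
  have h4 : Continuous fun η => Real.sqrt (120 / acousticDen η) :=
    (continuous_const.div h1 h3).sqrt
  unfold acousticSpeed
  refine Continuous.mul (by fun_prop) ((h4.div_const 2).add (Continuous.div ?_ (h4.const_mul 2) ?_))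
  · exact Continuous.mul (by fun_prop)
      ((h2.const_mul 120).div (h1.pow 2) fun η => pow_ne_zero 2 (h3 η))
  · intro η; have := sqrt_acoustic_pos η; positivity

/-- The bracket is positive even at `0`; only the factor `cos(η/2)` degenerates, at `π`. -/
lemma acousticSpeed_pos {η : ℝ} (h0 : 0 ≤ η) (hπ : η < Real.pi) : 0 < acousticSpeed η := by
  have hc : 0 < Real.cos (η / 2) :=
    Real.cos_pos_of_mem_Ioo ⟨by linarith [Real.pi_pos], by linarith⟩
  have hD : 0 < acousticDen η := by linarith [acousticDen_ge η]
  have hR := sqrt_acoustic_pos η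
  have hE := symbolSlope_pos η
  unfold acousticSpeed
  positivity

lemma acousticVelocity_eq {η : ℝ} (hη : η ∈ Set.Icc 0 Real.pi) :
    acousticVelocity η = acousticSpeed η :=
  (hasDerivWithinAt_acousticDispersion hη).derivWithin (uniqueDiffOn_Icc Real.pi_pos η hη)

lemma opticDen_pos (η : ℝ) : 0 < 1 + Real.sin (η / 2) ^ 2 := by positivity

/-- The numerator of the optic symbol. -/
noncomputable def opticNum (η : ℝ) : ℝ := 22 + 8 * Real.cos (η / 2) ^ 2 + 2 * Real.sqrt (discr η)

lemma opticNum_pos (η : ℝ) : 0 < opticNum η := by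
  have := sqrt_discr_pos η
  unfold opticNum; positivity

lemma opticSymbol_pos (η : ℝ) : 0 < opticSymbol η :=
  div_pos (opticNum_pos η) (opticDen_pos η)

lemma hasDerivAt_opticNum (η : ℝ) : HasDerivAt opticNum
    (2 * -(Real.cos (η / 2) * Real.sin (η / 2) * symbolSlope η)) η := by
  have h := ((hasDerivAt_cos_sq_add_sqrt_discr η).const_mul 2).const_add 22
  have e : opticNum = fun η => 22 + 2 * (4 * Real.cos (η / 2) ^ 2 + Real.sqrt (discr η)) := by
    funext η; unfold opticNum; ring
  rw [e]; exact h

/-- Minus the derivative of the optic dispersion relation. -/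
noncomputable def opticSpeed (η : ℝ) : ℝ :=
  Real.cos (η / 2) * Real.sin (η / 2) *
    ((2 * symbolSlope η * (1 + Real.sin (η / 2) ^ 2) + opticNum η) /
      (1 + Real.sin (η / 2) ^ 2) ^ 2 / (2 * Real.sqrt (opticSymbol η)))

lemma hasDerivAt_opticDispersion (η : ℝ) :
    HasDerivAt opticDispersion (-opticSpeed η) η := by
  have h1 := ((hasDerivAt_sin_half η).fun_pow 2).const_add 1
  have hD := opticDen_pos η
  have h2 := (hasDerivAt_opticNum η).fun_div h1 hD.ne'
  have h3 := h2.sqrt (div_pos (opticNum_pos η) hD).ne'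
  refine h3.congr_deriv ?_
  have hR : 0 < Real.sqrt (opticSymbol η) := Real.sqrt_pos.2 (opticSymbol_pos η)
  change _ / (2 * Real.sqrt (opticSymbol η)) = _
  unfold opticSpeed
  field_simp
  norm_num
  ring

lemma continuous_opticSymbol : Continuous opticSymbol := by
  have h := continuous_sqrt_discr
  unfold opticSymbol
  exact Continuous.div (by fun_prop) (by fun_prop) fun η => (opticDen_pos η).ne'

lemma continuous_opticSpeed : Continuous opticSpeed := by
  have h1 := continuous_symbolSlope
  have h2 := continuous_opticSymbol.sqrt
  have h3 := continuous_sqrt_discr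
  unfold opticSpeed opticNum
  refine Continuous.mul (by fun_prop) (Continuous.div (Continuous.div (by fun_prop) (by fun_prop)
    fun η => pow_ne_zero 2 (opticDen_pos η).ne') (by fun_prop) fun η => ?_)
  have : 0 < Real.sqrt (opticSymbol η) := Real.sqrt_pos.2 (opticSymbol_pos η)
  positivity

/-- The factor `cos(η/2) sin(η/2)` vanishes at both `0` and `π`, which is why the optic branch is
cut at both ends. -/
lemma opticSpeed_pos {η : ℝ} (h0 : 0 < η) (hπ : η < Real.pi) : 0 < opticSpeed η := by
  have hc : 0 < Real.cos (η / 2) :=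
    Real.cos_pos_of_mem_Ioo ⟨by linarith [Real.pi_pos], by linarith⟩
  have hs : 0 < Real.sin (η / 2) := Real.sin_pos_of_pos_of_lt_pi (by linarith) (by linarith)
  have hR : 0 < Real.sqrt (opticSymbol η) := Real.sqrt_pos.2 (opticSymbol_pos η)
  have hE := symbolSlope_pos η
  have hn := opticNum_pos η
  unfold opticSpeed
  positivity

lemma opticVelocity_eq {η : ℝ} (hη : η ∈ Set.Icc 0 Real.pi) :
    opticVelocity η = opticSpeed η := by
  rw [opticVelocity, (hasDerivAt_opticDispersion η).hasDerivWithinAt.derivWithin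
    (uniqueDiffOn_Icc Real.pi_pos η hη), neg_neg]

/-- A lower bound for the derivative on an interval gives a lower bound for increments. -/
lemma mul_sub_le_of_le_deriv {f f' : ℝ → ℝ} {a b m : ℝ} (ha : 0 ≤ a) (hb : b ≤ Real.pi)
    (hf : ∀ x ∈ Set.Icc 0 Real.pi, HasDerivWithinAt f (f' x) (Set.Icc 0 Real.pi) x)
    (hm : ∀ x ∈ Set.Icc a b, m ≤ f' x) {x y : ℝ} (hx : a ≤ x) (hxy : x ≤ y) (hy : y ≤ b) :
    m * (y - x) ≤ f y - f x := by
  have hsub : Set.Icc a b ⊆ Set.Icc 0 Real.pi := Set.Icc_subset_Icc ha hb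
  have hd : ∀ z ∈ interior (Set.Icc a b), HasDerivAt f (f' z) z := by
    intro z hz
    rw [interior_Icc] at hz
    exact (hf z (hsub (Set.Ioo_subset_Icc_self hz))).hasDerivAt
      (Icc_mem_nhds (ha.trans_lt hz.1) (hz.2.trans_le hb))
  refine (convex_Icc a b).mul_sub_le_image_sub_of_le_deriv
    (fun z hz => ((hf z (hsub hz)).mono hsub).continuousWithinAt)
    (fun z hz => (hd z hz).differentiableAt.differentiableWithinAt) (fun z hz => ?_)
    x ⟨hx, hxy.trans hy⟩ y ⟨hx.trans hxy, hy⟩ hxy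
  rw [(hd z hz).deriv]
  exact hm z (interior_subset hz)

lemma acousticSymbol_nonneg (η : ℝ) : 0 ≤ acousticSymbol η := by
  have := acousticSymbol_mul_den η
  have h2 := acousticDen_ge η
  by_contra! h
  nlinarith [sq_nonneg (Real.sin (η / 2))]

lemma acousticDispersion_sq (η : ℝ) : acousticDispersion η ^ 2 = acousticSymbol η :=
  Real.sq_sqrt (acousticSymbol_nonneg η)

lemma opticDispersion_sq (η : ℝ) : opticDispersion η ^ 2 = opticSymbol η :=
  Real.sq_sqrt (opticSymbol_pos η).le

lemma strictMonoOn_acousticDispersion :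
    StrictMonoOn acousticDispersion (Set.Icc 0 Real.pi) := by
  refine strictMonoOn_of_deriv_pos (convex_Icc _ _)
    (fun x hx => (hasDerivWithinAt_acousticDispersion hx).continuousWithinAt) fun x hx => ?_
  rw [interior_Icc] at hx
  rw [((hasDerivWithinAt_acousticDispersion (Set.Ioo_subset_Icc_self hx)).hasDerivAt
    (Icc_mem_nhds hx.1 hx.2)).deriv]
  exact acousticSpeed_pos hx.1.le hx.2

lemma strictAntiOn_opticDispersion :
    StrictAntiOn opticDispersion (Set.Icc 0 Real.pi) := by
  refine strictAntiOn_of_deriv_neg (convex_Icc _ _)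
    (fun x _ => (hasDerivAt_opticDispersion x).continuousAt.continuousWithinAt) fun x hx => ?_
  rw [interior_Icc] at hx
  rw [(hasDerivAt_opticDispersion x).deriv]
  linarith [opticSpeed_pos hx.1 hx.2]

lemma strictMonoOn_acousticSymbol : StrictMonoOn acousticSymbol (Set.Icc 0 Real.pi) := by
  intro x hx y hy hxy
  rw [← acousticDispersion_sq, ← acousticDispersion_sq]
  exact pow_lt_pow_left₀ (strictMonoOn_acousticDispersion hx hy hxy) (Real.sqrt_nonneg _)
    two_ne_zero

lemma strictAntiOn_opticSymbol : StrictAntiOn opticSymbol (Set.Icc 0 Real.pi) := by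
  intro x hx y hy hxy
  rw [← opticDispersion_sq, ← opticDispersion_sq]
  exact pow_lt_pow_left₀ (strictAntiOn_opticDispersion hx hy hxy) (Real.sqrt_nonneg _)
    two_ne_zero

lemma sqrt_discr_zero : Real.sqrt (discr 0) = 15 := by
  rw [Real.sqrt_eq_iff_mul_self_eq_of_pos (by norm_num)]
  norm_num [discr]

lemma acousticSymbol_zero : acousticSymbol 0 = 0 := by simp [acousticSymbol]

lemma acousticSymbol_pi : acousticSymbol Real.pi = 10 := by
  simp [acousticSymbol, discr]; norm_num

lemma opticSymbol_zero : opticSymbol 0 = 60 := by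
  rw [opticSymbol, sqrt_discr_zero]; norm_num

lemma opticSymbol_pi : opticSymbol Real.pi = 12 := by
  simp [opticSymbol, discr]; norm_num

lemma continuous_acousticSymbol : Continuous acousticSymbol := by
  have h := continuous_acousticDen
  change Continuous fun η => 120 * Real.sin (η / 2) ^ 2 / acousticDen η
  exact Continuous.div (by fun_prop) h fun η => by linarith [acousticDen_ge η]

/-- The intermediate value theorem provides a preimage, so `Function.invFunOn` takes no default
value here; the endpoint values `0` and `10` keep it inside the open interval. -/
lemma acousticWaveNumber_spec {L : ℝ} (h0 : 0 < L) (h1 : L < 10) :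
    acousticWaveNumber L ∈ Set.Ioo 0 Real.pi ∧ acousticSymbol (acousticWaveNumber L) = L := by
  have hex : L ∈ acousticSymbol '' Set.Icc 0 Real.pi := by
    apply intermediate_value_Icc Real.pi_pos.le continuous_acousticSymbol.continuousOn
    rw [acousticSymbol_zero, acousticSymbol_pi]
    exact ⟨h0.le, h1.le⟩
  have hm := Function.invFunOn_mem hex
  have he := Function.invFunOn_eq hex
  change acousticWaveNumber L ∈ _ at hm
  change acousticSymbol (acousticWaveNumber L) = L at he
  refine ⟨⟨lt_of_le_of_ne hm.1 fun h => ?_, lt_of_le_of_ne hm.2 fun h => ?_⟩, he⟩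
  · rw [← h, acousticSymbol_zero] at he; linarith
  · rw [h, acousticSymbol_pi] at he; linarith

lemma opticWaveNumber_spec {L : ℝ} (h0 : 12 < L) (h1 : L < 60) :
    opticWaveNumber L ∈ Set.Ioo 0 Real.pi ∧ opticSymbol (opticWaveNumber L) = L := by
  have hex : L ∈ opticSymbol '' Set.Icc 0 Real.pi := by
    apply intermediate_value_Icc' Real.pi_pos.le continuous_opticSymbol.continuousOn
    rw [opticSymbol_zero, opticSymbol_pi]
    exact ⟨h0.le, h1.le⟩
  have hm := Function.invFunOn_mem hex
  have he := Function.invFunOn_eq hex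
  change opticWaveNumber L ∈ _ at hm
  change opticSymbol (opticWaveNumber L) = L at he
  refine ⟨⟨lt_of_le_of_ne hm.1 fun h => ?_, lt_of_le_of_ne hm.2 fun h => ?_⟩, he⟩
  · rw [← h, opticSymbol_zero] at he; linarith
  · rw [h, opticSymbol_pi] at he; linarith

lemma opticWaveNumber_anti {L₁ L₂ : ℝ} (h0 : 12 < L₁) (h : L₁ ≤ L₂) (h1 : L₂ < 60) :
    opticWaveNumber L₂ ≤ opticWaveNumber L₁ := by
  obtain ⟨m1, e1⟩ := opticWaveNumber_spec h0 (h.trans_lt h1)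
  obtain ⟨m2, e2⟩ := opticWaveNumber_spec (h0.trans_le h) h1
  rw [← strictAntiOn_opticSymbol.le_iff_ge (Set.Ioo_subset_Icc_self m1)
    (Set.Ioo_subset_Icc_self m2), e1, e2]
  exact h

/-- For the velocities, `f` is given by `derivWithin` and `g` is its continuous closed form, whose
minimum on a compact interval is attained. -/
lemma exists_isLeast_of_eqOn {f g : ℝ → ℝ} (hg : Continuous g) {a b : ℝ} (hab : a ≤ b)
    (hfg : ∀ x ∈ Set.Icc a b, f x = g x) (hpos : ∀ x ∈ Set.Icc a b, 0 < g x) :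
    ∃ v, IsLeast (f '' Set.Icc a b) v ∧ 0 < v ∧ ∀ x ∈ Set.Icc a b, v ≤ g x := by
  obtain ⟨x, hx, hmin⟩ := isCompact_Icc.exists_isMinOn (Set.nonempty_Icc.2 hab) hg.continuousOn
  refine ⟨g x, ⟨⟨x, hx, hfg x hx⟩, ?_⟩, hpos x hx, fun y hy => hmin hy⟩
  rintro _ ⟨y, hy, rfl⟩
  rw [hfg y hy]
  exact hmin hy

/-- The minimal acoustic group velocity controls the increments of the dispersion relation. -/
lemma exists_min_acousticVelocity {L : ℝ} (h0 : 0 < L) (h1 : L < 10) :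
    ∃ va, IsLeast (acousticVelocity '' Set.Icc 0 (acousticWaveNumber L)) va ∧ 0 < va ∧
      ∀ x y, 0 ≤ x → x ≤ y → y ≤ acousticWaveNumber L →
        va * (y - x) ≤ acousticDispersion y - acousticDispersion x := by
  obtain ⟨hm, -⟩ := acousticWaveNumber_spec h0 h1
  obtain ⟨v, h1, h2, h3⟩ := exists_isLeast_of_eqOn (f := acousticVelocity)
    continuous_acousticSpeed hm.1.le
    (fun x hx => acousticVelocity_eq ⟨hx.1, hx.2.trans hm.2.le⟩)
    (fun x hx => acousticSpeed_pos hx.1 (hx.2.trans_lt hm.2))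
  exact ⟨v, h1, h2, fun x y hx hxy hy => mul_sub_le_of_le_deriv le_rfl hm.2.le
    (fun z hz => hasDerivWithinAt_acousticDispersion hz) h3 hx hxy hy⟩

/-- The minimal optic group velocity controls the increments of the dispersion relation. -/
lemma exists_min_opticVelocity {Lm Lp : ℝ} (h0 : 12 < Lm) (h : Lm ≤ Lp) (h1 : Lp < 60) :
    ∃ vo, IsLeast (opticVelocity '' Set.Icc (opticWaveNumber Lp) (opticWaveNumber Lm)) vo ∧
      0 < vo ∧ ∀ x y, opticWaveNumber Lp ≤ x → x ≤ y → y ≤ opticWaveNumber Lm →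
        vo * (y - x) ≤ opticDispersion x - opticDispersion y := by
  obtain ⟨hm, -⟩ := opticWaveNumber_spec h0 (h.trans_lt h1)
  obtain ⟨hp, -⟩ := opticWaveNumber_spec (h0.trans_le h) h1
  obtain ⟨v, h1, h2, h3⟩ := exists_isLeast_of_eqOn (f := opticVelocity)
    continuous_opticSpeed (opticWaveNumber_anti h0 h h1)
    (fun x hx => opticVelocity_eq ⟨hp.1.le.trans hx.1, hx.2.trans hm.2.le⟩)
    (fun x hx => opticSpeed_pos (hp.1.trans_le hx.1) (hx.2.trans_lt hm.2))
  refine ⟨v, h1, h2, fun x y hx hxy hy => ?_⟩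
  have := mul_sub_le_of_le_deriv (f := fun x => -opticDispersion x) hp.1.le hm.2.le
    (fun z hz => ((hasDerivAt_opticDispersion z).neg.congr_deriv
      (neg_neg _)).hasDerivWithinAt) h3 hx hxy hy
  linarith

/-- The quadratic equation satisfied by the symbols. -/
def IsSymbolAt (η L : ℝ) : Prop :=
  (2 - Real.cos (η / 2) ^ 2) * L ^ 2 - (16 * Real.cos (η / 2) ^ 2 + 44) * L +
    240 * (1 - Real.cos (η / 2) ^ 2) = 0

/-- With `c = cos(η/2)`, the acoustic symbol is the smaller root `(22 + 8c² - 2√Δ)/(2 - c²)`,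
rationalized by its conjugate. The optic one is the larger root. -/
lemma isSymbolAt_acousticSymbol (η : ℝ) : IsSymbolAt η (acousticSymbol η) := by
  have hD : acousticDen η ≠ 0 := by linarith [acousticDen_ge η]
  have hR : Real.sqrt (discr η) ^ 2 = discr η := Real.sq_sqrt (by linarith [one_le_discr η])
  have h1 : acousticSymbol η = 120 * (1 - Real.cos (η / 2) ^ 2) / acousticDen η := by
    rw [← Real.sin_sq]; rfl
  unfold IsSymbolAt
  rw [h1]
  field_simp
  unfold acousticDen
  unfold discr at hR ⊢
  linear_combination (240 * (1 - Real.cos (η / 2) ^ 2)) * hR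

lemma isSymbolAt_opticSymbol (η : ℝ) : IsSymbolAt η (opticSymbol η) := by
  have hR : Real.sqrt (discr η) ^ 2 = discr η := Real.sq_sqrt (by linarith [one_le_discr η])
  have hD : 2 - Real.cos (η / 2) ^ 2 ≠ 0 := by nlinarith [Real.cos_sq_le_one (η / 2)]
  have h1 : opticSymbol η = (22 + 8 * Real.cos (η / 2) ^ 2 + 2 * Real.sqrt (discr η)) /
      (2 - Real.cos (η / 2) ^ 2) := by
    rw [opticSymbol, Real.sin_sq]; congr 1; ring
  unfold IsSymbolAt
  rw [h1]
  field_simp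
  unfold discr at hR ⊢
  linear_combination 4 * hR

end P2Wave

/-! ### The finite element matrices and their eigenvectors. -/

namespace P2Wave

lemma mesh_pos (N : ℕ) : 0 < mesh N := by unfold mesh; positivity

lemma mesh_le_one (N : ℕ) : mesh N ≤ 1 := by
  unfold mesh
  rw [div_le_one (by positivity)]
  linarith [Nat.cast_nonneg (α := ℝ) N]

lemma mesh_mul (N : ℕ) : mesh N * ((N : ℝ) + 1) = 1 :=
  div_mul_cancel₀ _ (by positivity)

/-- Vectors are padded: entry `j` sits at position `j + 1` among `0, …, 2N + 2`. The zeros at both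
ends absorb the neighbours outside the matrix, so boundary rows need no separate formula. -/
lemma sum_fin_shift {R : Type*} [CommRing R] (N : ℕ) (f : ℕ → R) (h0 : f 0 = 0)
    (h1 : f (2 * N + 2) = 0) (p : ℕ) (hp : p ≤ 2 * N + 2) (a : R) :
    ∑ j : Fin (2 * N + 1), (if j.val + 1 = p then a else 0) * f (j.val + 1) = a * f p := by
  rcases Nat.eq_zero_or_pos p with rfl | hpos
  · simp [h0]
  rcases hp.eq_or_lt with rfl | hlt
  · rw [h1, mul_zero]
    refine Finset.sum_eq_zero fun j _ => ?_
    rw [if_neg (by omega), zero_mul]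
  · rw [Finset.sum_eq_single (⟨p - 1, by omega⟩ : Fin (2 * N + 1))]
    · simp [Nat.sub_add_cancel hpos]
    · intro j _ hj
      rw [if_neg, zero_mul]
      rintro rfl
      exact hj (Fin.ext (by simp))
    · simp

/-- The rows of a pentadiagonal matrix whose outer diagonals live on the odd rows. -/
lemma sum_pentadiagonal {R : Type*} [CommRing R] (N : ℕ) (f : ℕ → R) (h0 : f 0 = 0)
    (h1 : f (2 * N + 2) = 0) (d b e : R) (i : Fin (2 * N + 1)) :
    ∑ j : Fin (2 * N + 1), (if i = j then d
      else if i.val + 1 = j.val ∨ j.val + 1 = i.val then b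
      else if (i.val + 2 = j.val ∨ j.val + 2 = i.val) ∧ Odd i.val then e else 0) * f (j.val + 1) =
    d * f (i + 1) + b * (f i + f (i + 2)) +
      if Odd i.val then e * (f (i - 1) + f (i + 3)) else 0 := by
  have hi := i.isLt
  by_cases hodd : Odd i.val
  · have hodd' := Nat.odd_iff.1 hodd
    rw [if_pos hodd, mul_add, mul_add, ← sum_fin_shift N f h0 h1 (i + 1) (by omega) d,
      ← sum_fin_shift N f h0 h1 i (by omega) b, ← sum_fin_shift N f h0 h1 (i + 2) (by omega) b,
      ← sum_fin_shift N f h0 h1 (i - 1) (by omega) e,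
      ← sum_fin_shift N f h0 h1 (i + 3) (by omega) e]
    simp_rw [← Finset.sum_add_distrib, ← add_mul]
    refine Finset.sum_congr rfl fun j _ => ?_
    congr 1
    simp only [Fin.ext_iff, hodd, and_true]
    split_ifs <;> first | omega | simp
  · have hodd' := Nat.odd_iff.not.1 hodd
    rw [if_neg hodd, mul_add, add_zero, ← sum_fin_shift N f h0 h1 (i + 1) (by omega) d,
      ← sum_fin_shift N f h0 h1 i (by omega) b, ← sum_fin_shift N f h0 h1 (i + 2) (by omega) b]
    simp_rw [← Finset.sum_add_distrib, ← add_mul]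
    refine Finset.sum_congr rfl fun j _ => ?_
    congr 1
    simp only [Fin.ext_iff, hodd, and_false, if_false]
    split_ifs <;> first | omega | simp

lemma massMatrix_symm (N : ℕ) (i j : Fin (2 * N + 1)) :
    massMatrix N i j = massMatrix N j i := by
  rcases eq_or_ne i j with rfl | h
  · rfl
  unfold massMatrix
  rw [if_neg h, if_neg h.symm]
  simp only [Nat.odd_iff]
  split_ifs <;> first | rfl | omega

lemma stiffnessMatrix_symm (N : ℕ) (i j : Fin (2 * N + 1)) :
    stiffnessMatrix N i j = stiffnessMatrix N j i := by
  rcases eq_or_ne i j with rfl | h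
  · rfl
  unfold stiffnessMatrix
  rw [if_neg h, if_neg h.symm]
  simp only [Nat.odd_iff]
  split_ifs <;> first | rfl | omega

lemma act_apply {N : ℕ} (A : Matrix (Fin (2 * N + 1)) (Fin (2 * N + 1)) ℝ) (F : Vec N)
    (i : Fin (2 * N + 1)) : act A F i = ∑ j, (A i j : ℂ) * F j := rfl

lemma act_smul {N : ℕ} (A : Matrix (Fin (2 * N + 1)) (Fin (2 * N + 1)) ℝ) (c : ℂ) (F : Vec N) :
    act A (c • F) = c • act A F := Matrix.mulVec_smul _ _ _

lemma act_sum {N : ℕ} {ι : Type*} (A : Matrix (Fin (2 * N + 1)) (Fin (2 * N + 1)) ℝ)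
    (s : Finset ι) (F : ι → Vec N) : act A (∑ m ∈ s, F m) = ∑ m ∈ s, act A (F m) :=
  map_sum (Matrix.mulVecLin (A.map Complex.ofReal)) F s

lemma act_massMatrix (N : ℕ) (f : ℕ → ℂ) (h0 : f 0 = 0) (h1 : f (2 * N + 2) = 0)
    (i : Fin (2 * N + 1)) : act (massMatrix N) (fun j => f (j.val + 1)) i =
      ((if Even i.val then 8 * mesh N / 15 else 4 * mesh N / 15 : ℝ) : ℂ) * f (i + 1) +
      ((mesh N / 15 : ℝ) : ℂ) * (f i + f (i + 2)) +
      if Odd i.val then ((-(mesh N / 30) : ℝ) : ℂ) * (f (i - 1) + f (i + 3)) else 0 := by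
  rw [act_apply, ← sum_pentadiagonal N f h0 h1]
  refine Finset.sum_congr rfl fun j _ => ?_
  unfold massMatrix
  congr 1
  rw [apply_ite Complex.ofReal, apply_ite Complex.ofReal, apply_ite Complex.ofReal,
    apply_ite Complex.ofReal, Complex.ofReal_zero]

lemma act_stiffnessMatrix (N : ℕ) (f : ℕ → ℂ) (h0 : f 0 = 0) (h1 : f (2 * N + 2) = 0)
    (i : Fin (2 * N + 1)) : act (stiffnessMatrix N) (fun j => f (j.val + 1)) i =
      ((if Even i.val then 16 / (3 * mesh N) else 14 / (3 * mesh N) : ℝ) : ℂ) * f (i + 1) +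
      ((-(8 / (3 * mesh N)) : ℝ) : ℂ) * (f i + f (i + 2)) +
      if Odd i.val then ((1 / (3 * mesh N) : ℝ) : ℂ) * (f (i - 1) + f (i + 3)) else 0 := by
  rw [act_apply, ← sum_pentadiagonal N f h0 h1]
  refine Finset.sum_congr rfl fun j _ => ?_
  unfold stiffnessMatrix
  congr 1
  rw [apply_ite Complex.ofReal, apply_ite Complex.ofReal, apply_ite Complex.ofReal,
    apply_ite Complex.ofReal, Complex.ofReal_zero]

/-- The mass matrix is strictly diagonally dominant. -/
lemma sum_abs_massMatrix_le (N : ℕ) (i : Fin (2 * N + 1)) :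
    ∑ j ∈ Finset.univ.erase i, |massMatrix N i j| ≤
      if Even i.val then 2 * mesh N / 15 else mesh N / 5 := by
  have hh := mesh_pos N
  -- The row formula, applied to the indicator of the interior positions, computes the sum of the
  -- moduli of the off-diagonal entries.
  set f : ℕ → ℝ := fun p => if p = 0 ∨ p = 2 * N + 2 then 0 else 1 with hf
  have hf1 : ∀ p, f p ≤ 1 := fun p => by simp only [hf]; split_ifs <;> norm_num
  have h := sum_pentadiagonal N f (by simp [hf]) (by simp [hf]) 0 (mesh N / 15) (mesh N / 30) i
  have h2 : ∑ j ∈ Finset.univ.erase i, |massMatrix N i j| =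
      ∑ j : Fin (2 * N + 1), (if i = j then 0
      else if i.val + 1 = j.val ∨ j.val + 1 = i.val then mesh N / 15
      else if (i.val + 2 = j.val ∨ j.val + 2 = i.val) ∧ Odd i.val then mesh N / 30 else 0) *
        f (j.val + 1) := by
    rw [← Finset.add_sum_erase _ _ (Finset.mem_univ i)]
    simp only [if_true, zero_mul, zero_add]
    refine Finset.sum_congr rfl fun j hj => ?_
    have hne : i ≠ j := (Finset.ne_of_mem_erase hj).symm
    have hfj : f (j.val + 1) = 1 := by
      simp only [hf]; rw [if_neg]; have := j.isLt; omega
    rw [hfj, mul_one]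
    unfold massMatrix
    rw [if_neg hne, if_neg hne]
    split_ifs
    · exact abs_of_pos (by positivity)
    · rw [abs_neg]; exact abs_of_pos (by positivity)
    · exact abs_zero
  rw [h2, h]
  by_cases he : Even i.val
  · rw [if_pos he, if_neg (Nat.not_odd_iff_even.2 he)]
    nlinarith [hf1 i, hf1 (i + 2)]
  · rw [if_neg he, if_pos (Nat.not_even_iff_odd.1 he)]
    nlinarith [hf1 i, hf1 (i + 2), hf1 (i - 1), hf1 (i + 3)]

lemma abs_normSqZero_sub_le {N : ℕ} (F : Vec N) :
    |normSqZero F - ∑ i, massMatrix N i i * ‖F i‖ ^ 2| ≤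
      ∑ i : Fin (2 * N + 1),
        (if Even i.val then 2 * mesh N / 15 else mesh N / 5) * ‖F i‖ ^ 2 := by
  have h := norm_sum_offDiag_le Finset.univ (fun i => F i)
    (fun i j => (massMatrix N i j : ℂ)) (fun i j => |massMatrix N i j|)
    (fun i : Fin (2 * N + 1) => if Even i.val then 2 * mesh N / 15 else mesh N / 5)
    (fun i j => by rw [massMatrix_symm]) (fun i _ j _ => by rw [Complex.norm_real]; rfl)
    (fun i _ => sum_abs_massMatrix_le N i)
  refine le_trans ?_ h
  refine le_trans (le_of_eq ?_) (Complex.abs_re_le_norm _)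
  congr 1
  have e : euclInner (act (massMatrix N) F) F =
      ∑ i, ∑ j, F i * (starRingEnd ℂ) (F j) * (massMatrix N i j : ℂ) := by
    simp only [euclInner, act_apply, Finset.sum_mul]
    rw [Finset.sum_comm]
    refine Finset.sum_congr rfl fun i _ => Finset.sum_congr rfl fun j _ => ?_
    rw [massMatrix_symm]; ring
  have e2 : ∑ i, ∑ j, F i * (starRingEnd ℂ) (F j) * (massMatrix N i j : ℂ) =
      ((∑ i, massMatrix N i i * ‖F i‖ ^ 2 : ℝ) : ℂ) + ∑ i, ∑ j ∈ Finset.univ.erase i,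
        F i * (starRingEnd ℂ) (F j) * (massMatrix N i j : ℂ) := by
    rw [Complex.ofReal_sum, ← Finset.sum_add_distrib]
    refine Finset.sum_congr rfl fun i _ => ?_
    rw [← Finset.add_sum_erase _ _ (Finset.mem_univ i), Complex.mul_conj,
      Complex.normSq_eq_norm_sq]
    push_cast; ring
  rw [normSqZero, e, e2, Complex.add_re, Complex.ofReal_re]
  ring

lemma massMatrix_diag (N : ℕ) (i : Fin (2 * N + 1)) :
    massMatrix N i i = if Even i.val then 8 * mesh N / 15 else 4 * mesh N / 15 := by
  simp [massMatrix]

/-- The margin of diagonal dominance is `8h/15 - 2h/15` in midpoint rows and `4h/15 - 3h/15` in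
nodal rows; the smaller one is `h/15`. -/
lemma normSqZero_ge {N : ℕ} (F : Vec N) : mesh N / 15 * ∑ i, ‖F i‖ ^ 2 ≤ normSqZero F := by
  have h := (abs_le.1 (abs_normSqZero_sub_le F)).1
  have hh := mesh_pos N
  have : mesh N / 15 * ∑ i, ‖F i‖ ^ 2 +
      ∑ i : Fin (2 * N + 1), (if Even i.val then 2 * mesh N / 15 else mesh N / 5) * ‖F i‖ ^ 2 ≤
      ∑ i, massMatrix N i i * ‖F i‖ ^ 2 := by
    rw [Finset.mul_sum, ← Finset.sum_add_distrib]
    refine Finset.sum_le_sum fun i _ => ?_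
    rw [massMatrix_diag, ← add_mul]
    gcongr
    split_ifs <;> linarith
  linarith

lemma normSqZero_le {N : ℕ} (F : Vec N) : normSqZero F ≤ 2 * mesh N / 3 * ∑ i, ‖F i‖ ^ 2 := by
  have h := (abs_le.1 (abs_normSqZero_sub_le F)).2
  have hh := mesh_pos N
  have : ∑ i, massMatrix N i i * ‖F i‖ ^ 2 +
      ∑ i : Fin (2 * N + 1), (if Even i.val then 2 * mesh N / 15 else mesh N / 5) * ‖F i‖ ^ 2 ≤
      2 * mesh N / 3 * ∑ i, ‖F i‖ ^ 2 := by
    rw [Finset.mul_sum, ← Finset.sum_add_distrib]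
    refine Finset.sum_le_sum fun i _ => ?_
    rw [massMatrix_diag, ← add_mul]
    gcongr
    split_ifs <;> linarith
  linarith

/-- The mass matrix, as a complex matrix, is invertible. -/
lemma isUnit_massMatrix (N : ℕ) : IsUnit ((massMatrix N).map Complex.ofReal) := by
  rw [← Matrix.mulVec_injective_iff_isUnit]
  rw [← Matrix.coe_mulVecLin, injective_iff_map_eq_zero]
  intro F hF
  have h0 : act (massMatrix N) F = 0 := hF
  have h1 := normSqZero_ge F
  have h2 : normSqZero F = 0 := by simp [normSqZero, h0, euclInner]
  have h3 : ∑ i, ‖F i‖ ^ 2 ≤ 0 := by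
    by_contra! h
    have := mul_pos (div_pos (mesh_pos N) (by norm_num : (0 : ℝ) < 15)) h
    linarith
  funext i
  have h4 := (Finset.single_le_sum (f := fun i => ‖F i‖ ^ 2) (fun i _ => by positivity)
    (Finset.mem_univ i)).trans h3
  have h5 : ‖F i‖ ^ 2 = 0 := le_antisymm h4 (by positivity)
  simpa using h5

/-- The raw mode, extended by its boundary values to the positions `0, …, 2N + 2`. -/
noncomputable def modeExt (N k : ℕ) (L : ℝ) (p : ℕ) : ℂ :=
  (((if Even p then 1 else (40 + L) / (4 * (10 - L)) * Real.cos (k * Real.pi * mesh N / 2)) *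
    Real.sin (p * (k * Real.pi * mesh N / 2)) : ℝ) : ℂ)

lemma modeExt_zero (N k : ℕ) (L : ℝ) : modeExt N k L 0 = 0 := by simp [modeExt]

lemma modeExt_last (N k : ℕ) (L : ℝ) : modeExt N k L (2 * N + 2) = 0 := by
  have e : ((2 * N + 2 : ℕ) : ℝ) * (k * Real.pi * mesh N / 2) = k * Real.pi := by
    have := mesh_mul N
    push_cast
    linear_combination (k * Real.pi) * this
  rw [modeExt, e, Real.sin_nat_mul_pi, mul_zero, Complex.ofReal_zero]

lemma rawMode_eq (N k : ℕ) (L : ℝ) :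
    rawMode N k L = fun i => modeExt N k L (i.val + 1) := by
  funext i
  have e : (k : ℝ) * Real.pi * (((i.val : ℝ) + 1) * mesh N / 2) =
      ((i.val + 1 : ℕ) : ℝ) * (k * Real.pi * mesh N / 2) := by push_cast; ring
  simp only [rawMode, modeExt]
  rw [e]
  by_cases h : Odd i.val
  · rw [if_pos h, if_pos (by simpa [Nat.even_add_one] using h), one_mul]
  · rw [if_neg h, if_neg (by simpa [Nat.even_add_one] using h)]

/-- The raw modes are generalized eigenvectors. -/
lemma act_stiffnessMatrix_rawMode (N k : ℕ) {L : ℝ} (hL : L ≠ 10)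
    (h : IsSymbolAt (k * Real.pi * mesh N) L) :
    act (stiffnessMatrix N) (rawMode N k L) =
      ((L / mesh N ^ 2 : ℝ) : ℂ) • act (massMatrix N) (rawMode N k L) := by
  have hh := (mesh_pos N).ne'
  have hL' : 10 - L ≠ 0 := sub_ne_zero.2 hL.symm
  rw [rawMode_eq]
  funext i
  rw [Pi.smul_apply, act_stiffnessMatrix N _ (modeExt_zero N k L) (modeExt_last N k L),
    act_massMatrix N _ (modeExt_zero N k L) (modeExt_last N k L)]
  unfold IsSymbolAt at h
  set θ : ℝ := k * Real.pi * mesh N / 2 with hθ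
  rcases Nat.even_or_odd i.val with he | ho
  -- Midpoint rows hold for every `L ≠ 10`: the factor `(40 + L)/(4(10 - L))` is the one that solves
  -- them.
  · simp only [if_pos he, if_neg (Nat.not_odd_iff_even.2 he)]
    have p1 : ¬ Even (i.val + 1) := by simpa [Nat.even_add_one] using he
    have p2 : Even (i.val + 2) := he.add even_two
    simp only [modeExt, ← hθ, smul_eq_mul, add_zero, if_pos he, if_neg p1, if_pos p2, one_mul]
    norm_cast
    have e1 : Real.sin ((i.val : ℕ) * θ) + Real.sin (((i.val + 2 : ℕ) : ℝ) * θ) =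
        2 * Real.cos θ * Real.sin (((i.val + 1 : ℕ) : ℝ) * θ) := by
      have a1 : ((i.val : ℕ) : ℝ) * θ = ((i.val + 1 : ℕ) : ℝ) * θ - θ := by push_cast; ring
      have a2 : ((i.val + 2 : ℕ) : ℝ) * θ = ((i.val + 1 : ℕ) : ℝ) * θ + θ := by push_cast; ring
      rw [a1, a2, Real.sin_sub, Real.sin_add]; ring
    rw [e1]
    field_simp
    ring
  · obtain ⟨m, hm⟩ := ho
    have he : ¬ Even i.val := by rw [hm]; simp
    simp only [if_neg he, if_pos (Nat.not_even_iff_odd.1 he)]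
    rw [hm]
    simp only [modeExt, ← hθ, smul_eq_mul]
    have p1 : Even (2 * m + 1 + 1) := ⟨m + 1, by ring⟩
    have p2 : ¬ Even (2 * m + 1) := by simp
    have p3 : ¬ Even (2 * m + 1 + 2) := by rw [Nat.even_add]; simp
    have p4 : Even (2 * m + 1 - 1) := by simp
    have p5 : Even (2 * m + 1 + 3) := ⟨m + 2, by ring⟩
    simp only [if_pos p1, if_neg p2, if_neg p3, if_pos p4, if_pos p5, one_mul]
    norm_cast
    have e1 : Real.sin (((2 * m + 1 : ℕ) : ℝ) * θ) + Real.sin (((2 * m + 1 + 2 : ℕ) : ℝ) * θ) =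
        2 * Real.cos θ * Real.sin (((2 * m + 1 + 1 : ℕ) : ℝ) * θ) := by
      have a1 : ((2 * m + 1 : ℕ) : ℝ) * θ = ((2 * m + 1 + 1 : ℕ) : ℝ) * θ - θ := by
        push_cast; ring
      have a2 : ((2 * m + 1 + 2 : ℕ) : ℝ) * θ = ((2 * m + 1 + 1 : ℕ) : ℝ) * θ + θ := by
        push_cast; ring
      rw [a1, a2, Real.sin_sub, Real.sin_add]; ring
    have e2 : Real.sin (((2 * m + 1 - 1 : ℕ) : ℝ) * θ) +
        Real.sin (((2 * m + 1 + 3 : ℕ) : ℝ) * θ) =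
        2 * (2 * Real.cos θ ^ 2 - 1) * Real.sin (((2 * m + 1 + 1 : ℕ) : ℝ) * θ) := by
      have a1 : ((2 * m + 1 - 1 : ℕ) : ℝ) * θ = ((2 * m + 1 + 1 : ℕ) : ℝ) * θ - 2 * θ := by
        rw [Nat.add_sub_cancel]; push_cast; ring
      have a2 : ((2 * m + 1 + 3 : ℕ) : ℝ) * θ = ((2 * m + 1 + 1 : ℕ) : ℝ) * θ + 2 * θ := by
        push_cast; ring
      rw [a1, a2, Real.sin_sub, Real.sin_add, Real.cos_two_mul]; ring
    rw [← mul_add, e1, e2]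
    field_simp
    -- Only the nodal rows require the quadratic equation for `L`.
    linear_combination (900 * Real.sin (((2 * m + 1 + 1 : ℕ) : ℝ) * θ)) * h

end P2Wave

/-! ### Norms and boundary values of the modes. -/

namespace P2Wave

-- By `sin² = (1 - cos)/2` it is enough that the cosines of `2jkπh` sum to zero. They are real parts
-- of the powers of an `(N+1)`-th root of unity, which differs from `1` because `1 ≤ k ≤ N`.
open Complex in
lemma sum_sin_sq (N k : ℕ) (hk : 1 ≤ k) (hkN : k ≤ N) :
    ∑ j ∈ Finset.range (N + 1), Real.sin (j * (k * Real.pi * mesh N)) ^ 2 = ((N : ℝ) + 1) / 2 := by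
  have hN : ((N : ℝ) + 1) ≠ 0 := by positivity
  have hk0 : (0 : ℝ) < k := by exact_mod_cast hk
  have hkN' : (k : ℝ) < N + 1 := by exact_mod_cast Nat.lt_succ_of_le hkN
  set φ : ℝ := 2 * (k * Real.pi * mesh N) with hφ
  have hφ0 : 0 < φ := by have := mesh_pos N; have := Real.pi_pos; positivity
  have hφ1 : φ < 2 * Real.pi := by
    have h1 := mesh_mul N
    have h2 := mesh_pos N
    have h3 : k * mesh N < 1 := by nlinarith
    nlinarith [Real.pi_pos]
  have hne : exp (φ * I) ≠ 1 := by
    intro h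
    have h1 : Real.cos φ = 1 := by
      have := congrArg re h
      rwa [exp_ofReal_mul_I_re, one_re] at this
    rw [Real.cos_eq_one_iff_of_lt_of_lt (by linarith) hφ1] at h1
    linarith
  have hpow : exp (φ * I) ^ (N + 1) = 1 := by
    rw [← exp_nat_mul, exp_eq_one_iff]
    refine ⟨k, ?_⟩
    have h1 : ((N : ℝ) + 1) * φ = 2 * k * Real.pi := by
      linear_combination (2 * k * Real.pi) * mesh_mul N
    have h2 : ((N : ℂ) + 1) * φ = 2 * k * Real.pi := by exact_mod_cast h1
    push_cast
    linear_combination I * h2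
  have hgeom : ∑ j ∈ Finset.range (N + 1), exp (φ * I) ^ j = 0 := by
    have := geom_sum_mul (exp (φ * I)) (N + 1)
    rw [hpow, sub_self] at this
    exact (mul_eq_zero.1 this).resolve_right (sub_ne_zero.2 hne)
  have hcos : ∑ j ∈ Finset.range (N + 1), Real.cos (j * φ) = 0 := by
    have := congrArg re hgeom
    rw [re_sum, zero_re] at this
    rw [← this]
    refine Finset.sum_congr rfl fun j _ => ?_
    have e : ((j : ℝ) * φ : ℝ) * I = j * (φ * I) := by rw [ofReal_mul, ofReal_natCast, mul_assoc]
    rw [← exp_nat_mul, ← e, exp_ofReal_mul_I_re]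
  have hterm : ∀ j : ℕ, Real.sin (j * (k * Real.pi * mesh N)) ^ 2 =
      1 / 2 - Real.cos (j * φ) / 2 := by
    intro j
    rw [Real.sin_sq_eq_half_sub, hφ]
    ring_nf
  simp_rw [hterm]
  rw [Finset.sum_sub_distrib, ← Finset.sum_div _ (fun j : ℕ => Real.cos (j * φ)), hcos,
    Finset.sum_const, Finset.card_range, nsmul_eq_mul]
  push_cast
  ring

/-- The nodal components alone have square sum `(N+1)/2`; the factor `h/15` turns it into `1/30`,
whatever `L` is. -/
lemma normSqZero_rawMode_ge (N k : ℕ) (L : ℝ) (hk : 1 ≤ k) (hkN : k ≤ N) :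
    1 / 30 ≤ normSqZero (rawMode N k L) := by
  refine le_trans ?_ (normSqZero_ge _)
  have h1 : ((N : ℝ) + 1) / 2 ≤ ∑ i, ‖rawMode N k L i‖ ^ 2 := by
    rw [← sum_sin_sq N k hk hkN, Finset.sum_range_succ', rawMode_eq,
      Fin.sum_univ_eq_sum_range (fun i => ‖modeExt N k L (i + 1)‖ ^ 2)]
    simp only [Nat.cast_zero, zero_mul, Real.sin_zero, ne_eq, OfNat.ofNat_ne_zero,
      not_false_eq_true, zero_pow, add_zero]
    calc ∑ j ∈ Finset.range N, Real.sin (((j + 1 : ℕ) : ℝ) * (k * Real.pi * mesh N)) ^ 2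
        = ∑ j ∈ Finset.range N, ‖modeExt N k L (2 * j + 1 + 1)‖ ^ 2 := by
          refine Finset.sum_congr rfl fun j _ => ?_
          rw [modeExt, if_pos ⟨j + 1, by ring⟩, one_mul, Complex.norm_real, Real.norm_eq_abs,
            sq_abs]
          congr 2
          push_cast; ring
      _ = ∑ i ∈ (Finset.range N).image (fun j => 2 * j + 1), ‖modeExt N k L (i + 1)‖ ^ 2 := by
          rw [Finset.sum_image fun a _ b _ h => by simpa using h]
      _ ≤ _ := by
          refine Finset.sum_le_sum_of_subset_of_nonneg (fun i hi => ?_) fun _ _ _ => by positivity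
          obtain ⟨j, hj, rfl⟩ := Finset.mem_image.1 hi
          rw [Finset.mem_range] at hj ⊢
          omega
  have h2 := mesh_mul N
  have h3 := mesh_pos N
  nlinarith

lemma normSqZero_rawMode_le (N k : ℕ) {L A : ℝ} (hA : ((40 + L) / (4 * (10 - L))) ^ 2 ≤ A) :
    normSqZero (rawMode N k L) ≤ 4 / 3 * (1 + A) := by
  refine (normSqZero_le _).trans ?_
  have hA0 : 0 ≤ A := (sq_nonneg _).trans hA
  have h1 : ∑ i, ‖rawMode N k L i‖ ^ 2 ≤ (2 * N + 1) * (1 + A) := by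
    have : ∀ i, ‖rawMode N k L i‖ ^ 2 ≤ 1 + A := by
      intro i
      rw [rawMode_eq]
      simp only [modeExt]
      rw [Complex.norm_real, Real.norm_eq_abs, sq_abs, mul_pow]
      have hs := Real.sin_sq_le_one (((i.val + 1 : ℕ) : ℝ) * (k * Real.pi * mesh N / 2))
      have hc := Real.cos_sq_le_one (k * Real.pi * mesh N / 2)
      refine (mul_le_of_le_one_right (by positivity) hs).trans ?_
      split_ifs
      · linarith
      · rw [mul_pow]
        refine (mul_le_of_le_one_right (by positivity) hc).trans ?_
        linarith
    refine (Finset.sum_le_sum fun i _ => this i).trans (le_of_eq ?_)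
    rw [Finset.sum_const, Finset.card_univ, Fintype.card_fin, nsmul_eq_mul]
    push_cast; ring
  have h2 := mesh_mul N
  have h3 := mesh_pos N
  have h4 : mesh N * (2 * N + 1) ≤ 2 := by linarith
  calc _ ≤ 2 * mesh N / 3 * ((2 * N + 1) * (1 + A)) := by gcongr
    _ = 2 / 3 * (mesh N * (2 * N + 1)) * (1 + A) := by ring
    _ ≤ 2 / 3 * 2 * (1 + A) := by gcongr
    _ = _ := by ring

/-- The value of the modes with wave number `k` at the last interior node. -/
noncomputable def nodeValue (N k : ℕ) : ℝ := Real.sin (k * Real.pi * (N * mesh N))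

/-- The last interior node is `1 - h`, and `sin(kπ) = 0`. -/
lemma nodeValue_sq (N k : ℕ) : nodeValue N k ^ 2 = Real.sin (k * Real.pi * mesh N) ^ 2 := by
  have e : k * Real.pi * (N * mesh N) = k * Real.pi - k * Real.pi * mesh N := by
    linear_combination (k * Real.pi) * mesh_mul N
  have h : Real.cos (k * Real.pi) ^ 2 = 1 := by
    rw [Real.cos_sq', Real.sin_nat_mul_pi]; norm_num
  rw [nodeValue, e, Real.sin_sub, Real.sin_nat_mul_pi]
  linear_combination Real.sin (k * Real.pi * mesh N) ^ 2 * h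

lemma act_observationMatrix_rawMode (N k : ℕ) (L : ℝ) (i : Fin (2 * N + 1)) :
    act (observationMatrix N) (rawMode N k L) i =
      if i.val = 2 * N then -((1 / mesh N : ℝ) : ℂ) * nodeValue N k else 0 := by
  rw [act_apply]
  by_cases hi : i.val = 2 * N
  · rw [if_pos hi]
    have hlast : modeExt N k L (2 * N) = nodeValue N k := by
      rw [modeExt, if_pos (even_two_mul N), one_mul, nodeValue]
      congr 2
      push_cast; ring
    rw [← hlast, ← sum_fin_shift N _ (modeExt_zero N k L) (modeExt_last N k L) (2 * N) (by omega),
      rawMode_eq]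
    refine Finset.sum_congr rfl fun j _ => ?_
    simp only [observationMatrix, hi, true_and]
    congr 1
    split_ifs <;> simp
  · rw [if_neg hi]
    exact Finset.sum_eq_zero fun j _ => by simp [observationMatrix, hi]

/-- The observation of a superposition of modes. -/
lemma euclNormSq_act_observationMatrix_sum (N : ℕ) {ι : Type*} (s : Finset ι) (c : ι → ℂ)
    (k : ι → ℕ) (L : ι → ℝ) :
    euclNormSq (act (observationMatrix N) (∑ m ∈ s, c m • rawMode N (k m) (L m))) =
      ‖∑ m ∈ s, ((nodeValue N (k m) / mesh N : ℝ) : ℂ) * c m‖ ^ 2 := by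
  rw [act_sum]
  simp_rw [act_smul]
  unfold euclNormSq
  simp only [Finset.sum_apply, Pi.smul_apply, smul_eq_mul, act_observationMatrix_rawMode]
  rw [Finset.sum_eq_single (⟨2 * N, by omega⟩ : Fin (2 * N + 1))]
  · rw [← norm_neg, ← Finset.sum_neg_distrib]
    congr 2
    refine Finset.sum_congr rfl fun m _ => ?_
    simp only [if_true]
    push_cast; ring
  · intro i _ hi
    have : i.val ≠ 2 * N := fun h => hi (Fin.ext h)
    simp [this]
  · simp

end P2Wave

/-! ### Modal expansion of the solutions. -/

namespace P2Wave

lemma euclInner_act_symm {N : ℕ} (A : Matrix (Fin (2 * N + 1)) (Fin (2 * N + 1)) ℝ)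
    (hA : ∀ i j, A i j = A j i) (F G : Vec N) :
    euclInner (act A F) G = euclInner F (act A G) := by
  simp only [euclInner, act_apply, Finset.sum_mul, map_sum, Finset.mul_sum, map_mul,
    Complex.conj_ofReal]
  rw [Finset.sum_comm]
  refine Finset.sum_congr rfl fun i _ => Finset.sum_congr rfl fun j _ => ?_
  rw [hA]; ring

lemma euclInner_smul_left {N : ℕ} (c : ℂ) (F G : Vec N) :
    euclInner (c • F) G = c * euclInner F G := by
  simp [euclInner, Finset.mul_sum, mul_assoc]

lemma euclInner_smul_right {N : ℕ} (c : ℂ) (F G : Vec N) :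
    euclInner F (c • G) = (starRingEnd ℂ) c * euclInner F G := by
  simp only [euclInner, Finset.mul_sum, Pi.smul_apply, smul_eq_mul, map_mul]
  exact Finset.sum_congr rfl fun i _ => by ring

lemma euclInner_sum_left {N : ℕ} {ι : Type*} (s : Finset ι) (F : ι → Vec N) (G : Vec N) :
    euclInner (∑ m ∈ s, F m) G = ∑ m ∈ s, euclInner (F m) G := by
  simp only [euclInner, Finset.sum_apply, Finset.sum_mul]
  exact Finset.sum_comm

lemma euclInner_sum_right {N : ℕ} {ι : Type*} (s : Finset ι) (F : Vec N) (G : ι → Vec N) :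
    euclInner F (∑ m ∈ s, G m) = ∑ m ∈ s, euclInner F (G m) := by
  simp only [euclInner, Finset.sum_apply, Finset.mul_sum, map_sum]
  exact Finset.sum_comm

/-- Generalized eigenvectors with distinct eigenvalues are orthogonal. -/
lemma euclInner_act_massMatrix_eq_zero {N : ℕ} {F G : Vec N} {a b : ℝ} (hab : a ≠ b)
    (hF : act (stiffnessMatrix N) F = (a : ℂ) • act (massMatrix N) F)
    (hG : act (stiffnessMatrix N) G = (b : ℂ) • act (massMatrix N) G) :
    euclInner (act (massMatrix N) F) G = 0 := by
  have h := euclInner_act_symm _ (stiffnessMatrix_symm N) F G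
  rw [hF, hG, euclInner_smul_left, euclInner_smul_right,
    ← euclInner_act_symm _ (massMatrix_symm N), Complex.conj_ofReal, ← sub_eq_zero,
    ← sub_mul, mul_eq_zero] at h
  refine h.resolve_left ?_
  rw [sub_eq_zero]
  exact_mod_cast hab

section Modes

variable {N : ℕ} {ι : Type*} {s : Finset ι} {φ : ι → Vec N} {ω : ι → ℝ}

lemma euclInner_act_massMatrix_sum
    (hφ : ∀ m ∈ s, act (stiffnessMatrix N) (φ m) = ((ω m ^ 2 : ℝ) : ℂ) • act (massMatrix N) (φ m))
    (hω : Set.InjOn (fun m => ω m ^ 2) s) (a b : ι → ℂ) :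
    euclInner (act (massMatrix N) (∑ m ∈ s, a m • φ m)) (∑ m ∈ s, b m • φ m) =
      ∑ m ∈ s, a m * (starRingEnd ℂ) (b m) * euclInner (act (massMatrix N) (φ m)) (φ m) := by
  rw [act_sum, euclInner_sum_left]
  refine Finset.sum_congr rfl fun m hm => ?_
  rw [euclInner_sum_right, Finset.sum_eq_single m, act_smul, euclInner_smul_left,
    euclInner_smul_right, mul_assoc]
  · intro m' hm' hne
    rw [act_smul, euclInner_smul_left, euclInner_smul_right,
      euclInner_act_massMatrix_eq_zero (fun h => hne (hω hm' hm h.symm)) (hφ m hm) (hφ m' hm'),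
      mul_zero, mul_zero]
  · exact fun h => absurd hm h

lemma normSqZero_sum
    (hφ : ∀ m ∈ s, act (stiffnessMatrix N) (φ m) = ((ω m ^ 2 : ℝ) : ℂ) • act (massMatrix N) (φ m))
    (hω : Set.InjOn (fun m => ω m ^ 2) s) (a : ι → ℂ) :
    normSqZero (∑ m ∈ s, a m • φ m) = ∑ m ∈ s, normSqZero (φ m) * ‖a m‖ ^ 2 := by
  rw [normSqZero, euclInner_act_massMatrix_sum hφ hω, Complex.re_sum]
  refine Finset.sum_congr rfl fun m _ => ?_
  rw [Complex.mul_conj, Complex.re_ofReal_mul, Complex.normSq_eq_norm_sq, normSqZero, mul_comm]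

lemma normSqOne_sum
    (hφ : ∀ m ∈ s, act (stiffnessMatrix N) (φ m) = ((ω m ^ 2 : ℝ) : ℂ) • act (massMatrix N) (φ m))
    (hω : Set.InjOn (fun m => ω m ^ 2) s) (a : ι → ℂ) :
    normSqOne (∑ m ∈ s, a m • φ m) = ∑ m ∈ s, normSqZero (φ m) * (ω m ^ 2 * ‖a m‖ ^ 2) := by
  have h : act (stiffnessMatrix N) (∑ m ∈ s, a m • φ m) =
      act (massMatrix N) (∑ m ∈ s, (((ω m ^ 2 : ℝ) : ℂ) * a m) • φ m) := by
    rw [act_sum, act_sum]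
    refine Finset.sum_congr rfl fun m hm => ?_
    rw [act_smul, act_smul, hφ m hm, smul_smul, mul_comm (a m)]
  rw [normSqOne, h, euclInner_act_massMatrix_sum hφ hω, Complex.re_sum]
  refine Finset.sum_congr rfl fun m _ => ?_
  rw [mul_assoc ((ω m ^ 2 : ℝ) : ℂ), Complex.mul_conj, ← Complex.ofReal_mul,
    Complex.re_ofReal_mul, Complex.normSq_eq_norm_sq, normSqZero, mul_comm]

end Modes

/-- Solutions are determined by their data at the final time. -/
lemma IsSolution.eqOn {N : ℕ} {T : ℝ} {U₀ U₁ : Vec N} {U W : ℝ → Vec N}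
    (hU : IsSolution N T U₀ U₁ U) (hW : IsSolution N T U₀ U₁ W) : Set.EqOn U W (Set.Icc 0 T) := by
  obtain ⟨V, A, hV, hA, hode, hUT, hVT⟩ := hU
  obtain ⟨V', A', hV', hA', hode', hUT', hVT'⟩ := hW
  set M := (massMatrix N).map Complex.ofReal with hM
  set S := (stiffnessMatrix N).map Complex.ofReal with hS
  have hMu : IsUnit M.det := (Matrix.isUnit_iff_isUnit_det M).1 (isUnit_massMatrix N)
  have key : ∀ X Y : Vec N, act (massMatrix N) X + act (stiffnessMatrix N) Y = 0 →
      X = -(M⁻¹ * S).mulVec Y := by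
    intro X Y h
    have h1 : M.mulVec X = -S.mulVec Y := eq_neg_of_add_eq_zero_left h
    have h2 := congrArg (M⁻¹.mulVec) h1
    rwa [Matrix.mulVec_mulVec, Matrix.nonsing_inv_mul _ hMu, Matrix.one_mulVec,
      Matrix.mulVec_neg, Matrix.mulVec_mulVec] at h2
  let B : Vec N →ₗ[ℂ] Vec N := Matrix.mulVecLin (M⁻¹ * S)
  -- The equation becomes the linear, hence Lipschitz, system `(U, V)' = (V, -M⁻¹ S U)`. The data
  -- are prescribed at `T`, so uniqueness is used backwards in time.
  let Φ : (Vec N × Vec N) →ₗ[ℂ] (Vec N × Vec N) :=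
    LinearMap.prod (LinearMap.snd ℂ _ _) (-(B ∘ₗ LinearMap.fst ℂ _ _))
  have hlip := (LinearMap.toContinuousLinearMap Φ).lipschitz
  have hsol : ∀ (U V A : ℝ → Vec N),
      (∀ t ∈ Set.Icc 0 T, HasDerivWithinAt U (V t) (Set.Icc 0 T) t) →
      (∀ t ∈ Set.Icc 0 T, HasDerivWithinAt V (A t) (Set.Icc 0 T) t) →
      (∀ t ∈ Set.Icc 0 T, act (massMatrix N) (A t) + act (stiffnessMatrix N) (U t) = 0) →
      ∀ t ∈ Set.Icc 0 T,
        HasDerivWithinAt (fun t => (U t, V t)) (Φ (U t, V t)) (Set.Icc 0 T) t := by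
    intro U V A hV hA hode t ht
    have := (hV t ht).prodMk (hA t ht)
    rwa [key _ _ (hode t ht)] at this
  have h1 := hsol U V A hV hA hode
  have h2 := hsol W V' A' hV' hA' hode'
  have hIic : ∀ t ∈ Set.Ioc 0 T, Set.Icc 0 T ∈ nhdsWithin t (Set.Iic t) := fun t ht =>
    Filter.mem_of_superset (Icc_mem_nhdsLE ht.1) (Set.Icc_subset_Icc_right ht.2)
  have := ODE_solution_unique_of_mem_Icc_left (v := fun _ => Φ) (s := fun _ => Set.univ)
    (f := fun t => (U t, V t)) (g := fun t => (W t, V' t)) (a := 0) (b := T)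
    (fun t _ => hlip.lipschitzOnWith)
    (fun t ht => (h1 t ht).continuousWithinAt)
    (fun t ht => (h1 t (Set.Ioc_subset_Icc_self ht)).mono_of_mem_nhdsWithin (hIic t ht))
    (fun _ _ => Set.mem_univ _)
    (fun t ht => (h2 t ht).continuousWithinAt)
    (fun t ht => (h2 t (Set.Ioc_subset_Icc_self ht)).mono_of_mem_nhdsWithin (hIic t ht))
    (fun _ _ => Set.mem_univ _) (by simp only [hUT, hVT, hUT', hVT'])
  exact fun t ht => congrArg Prod.fst (this ht)

open Complex in
lemma hasDerivAt_cexp_I_mul (w t : ℝ) :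
    HasDerivAt (fun t : ℝ => exp (I * (w * t : ℝ))) (I * w * exp (I * (w * t : ℝ))) t := by
  have : HasDerivAt (fun t : ℝ => exp (I * (w * t : ℝ)))
      (exp (I * (w * t : ℝ)) * (I * ((w * 1 : ℝ) : ℂ))) t :=
    ((((hasDerivAt_id t).const_mul w).ofReal_comp).const_mul I).cexp
  refine this.congr_deriv ?_
  push_cast; ring

section Modes

variable {N : ℕ} {ι : Type*} {s : Finset ι} {φ : ι → Vec N} {ω : ι → ℝ}

open Complex in
/-- Superpositions of time-harmonic modes solve the semi-discrete wave equation. -/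
lemma isSolution_sum (T : ℝ)
    (hφ : ∀ m ∈ s, act (stiffnessMatrix N) (φ m) = ((ω m ^ 2 : ℝ) : ℂ) • act (massMatrix N) (φ m))
    (p q : ι → ℂ) :
    IsSolution N T
      (∑ m ∈ s, (p m * exp (I * (ω m * T : ℝ)) + q m * exp (I * (-ω m * T : ℝ))) • φ m)
      (∑ m ∈ s, (I * ω m * (p m * exp (I * (ω m * T : ℝ)) - q m * exp (I * (-ω m * T : ℝ)))) • φ m)
      (fun t => ∑ m ∈ s,
        (p m * exp (I * (ω m * t : ℝ)) + q m * exp (I * (-ω m * t : ℝ))) • φ m) := by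
  refine ⟨fun t => ∑ m ∈ s,
    (I * ω m * (p m * exp (I * (ω m * t : ℝ)) - q m * exp (I * (-ω m * t : ℝ)))) • φ m,
    fun t => ∑ m ∈ s, (-((ω m ^ 2 : ℝ) : ℂ) *
      (p m * exp (I * (ω m * t : ℝ)) + q m * exp (I * (-ω m * t : ℝ)))) • φ m,
    fun t _ => ?_, fun t _ => ?_, fun t _ => ?_, rfl, rfl⟩
  · refine (HasDerivAt.fun_sum fun m _ => HasDerivAt.smul_const ?_ _).hasDerivWithinAt
    refine (((hasDerivAt_cexp_I_mul (ω m) t).const_mul (p m)).add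
      ((hasDerivAt_cexp_I_mul (-ω m) t).const_mul (q m))).congr_deriv ?_
    push_cast; ring
  · refine (HasDerivAt.fun_sum fun m _ => HasDerivAt.smul_const ?_ _).hasDerivWithinAt
    refine ((((hasDerivAt_cexp_I_mul (ω m) t).const_mul (p m)).sub
      ((hasDerivAt_cexp_I_mul (-ω m) t).const_mul (q m))).const_mul (I * ω m)).congr_deriv ?_
    push_cast
    linear_combination ((ω m : ℂ) ^ 2 * (p m * exp (I * (ω m * t)) +
      q m * exp (I * (-ω m * t)))) * I_sq
  · rw [act_sum, act_sum, ← Finset.sum_add_distrib]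
    refine Finset.sum_eq_zero fun m hm => ?_
    rw [act_smul, act_smul, hφ m hm, smul_smul, ← add_smul]
    convert zero_smul ℂ _ using 2
    ring

open Complex in
/-- The modal expansion of a solution and its energy. -/
lemma IsSolution.exists_expansion {T : ℝ}
    (hφ : ∀ m ∈ s, act (stiffnessMatrix N) (φ m) = ((ω m ^ 2 : ℝ) : ℂ) • act (massMatrix N) (φ m))
    (hω : Set.InjOn (fun m => ω m ^ 2) s) (hω0 : ∀ m ∈ s, 0 < ω m) {U₀ U₁ : Vec N}
    {U : ℝ → Vec N} (hU : IsSolution N T U₀ U₁ U)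
    (h₀ : ∃ u : ι → ℂ, U₀ = ∑ m ∈ s, u m • φ m) (h₁ : ∃ v : ι → ℂ, U₁ = ∑ m ∈ s, v m • φ m) :
    ∃ p q : ι → ℂ,
      (∀ t ∈ Set.Icc 0 T, U t = ∑ m ∈ s,
        (p m * exp (I * (ω m * t : ℝ)) + q m * exp (I * (-ω m * t : ℝ))) • φ m) ∧
      energy U₀ U₁ = ∑ m ∈ s, normSqZero (φ m) * ω m ^ 2 * (‖p m‖ ^ 2 + ‖q m‖ ^ 2) := by
  obtain ⟨u, rfl⟩ := h₀
  obtain ⟨v, rfl⟩ := h₁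
  have hexp : ∀ w : ℝ, exp (I * (w * -T : ℝ)) * exp (I * (w * T : ℝ)) = 1 := by
    intro w
    rw [← exp_add, ← mul_add, ← ofReal_add, mul_neg, neg_add_cancel, ofReal_zero, mul_zero,
      exp_zero]
  -- At `t = T` the data require the two phased amplitudes to have sum `u` and difference `v/(iω)`;
  -- the exponentials carry them back to time `0`.
  refine ⟨fun m => (u m - I * (v m / ω m)) / 2 * exp (I * (ω m * -T : ℝ)),
    fun m => (u m + I * (v m / ω m)) / 2 * exp (I * (-ω m * -T : ℝ)), ?_, ?_⟩
  · apply hU.eqOn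
    convert isSolution_sum T hφ _ _ using 1
    · refine Finset.sum_congr rfl fun m _ => ?_
      rw [mul_assoc, mul_assoc, hexp, hexp]
      congr 1; ring
    · refine Finset.sum_congr rfl fun m hm => ?_
      rw [mul_assoc _ (exp _) (exp _), mul_assoc _ (exp _) (exp _), hexp, hexp]
      congr 1
      have : (ω m : ℂ) ≠ 0 := by exact_mod_cast (hω0 m hm).ne'
      field_simp
      linear_combination (2 * v m) * I_sq
  · rw [energy, normSqOne_sum hφ hω, normSqZero_sum hφ hω, ← Finset.sum_add_distrib,
      Finset.mul_sum]
    refine Finset.sum_congr rfl fun m hm => ?_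
    have hw := hω0 m hm
    rw [norm_mul_cexp_I, norm_mul_cexp_I, norm_div, norm_div, div_pow, div_pow]
    -- The parallelogram law removes the cross terms between the two signs of the frequency.
    have hpar := parallelogram_law_with_norm ℝ (u m) (I * (v m / ω m))
    have e1 : ‖I * (v m / ω m)‖ = ‖v m‖ / ω m := by
      rw [norm_mul, norm_I, one_mul, norm_div, norm_real, Real.norm_eq_abs, abs_of_pos hw]
    have e2 : ‖(2 : ℂ)‖ = 2 := by norm_num
    rw [e1] at hpar
    rw [e2]
    have e3 : ω m ^ 2 * (‖v m‖ / ω m) ^ 2 = ‖v m‖ ^ 2 := by field_simp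
    linear_combination (-(normSqZero (φ m) * ω m ^ 2) / 4) * hpar -
      (normSqZero (φ m) / 2) * e3

end Modes

end P2Wave

/-! ### Spectral gap and comparison of observation with energy. -/

namespace P2Wave

/-- The wave numbers `k π h` of the truncated space: acoustic ones on the left, optic ones on the
right. -/
noncomputable def modeIndices (N : ℕ) (ηa η₁ η₂ : ℝ) : Finset (ℕ ⊕ ℕ) :=
  ((Finset.Icc 1 N).filter fun k : ℕ => k * Real.pi * mesh N ≤ ηa).disjSum
    ((Finset.Icc 1 N).filter fun k : ℕ => η₁ ≤ k * Real.pi * mesh N ∧ k * Real.pi * mesh N ≤ η₂)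

/-- The wave number of a mode. -/
def modeNumber : ℕ ⊕ ℕ → ℕ := Sum.elim id id

/-- The eigenvalue of a mode, scaled by `h²`. -/
noncomputable def modeSymbol (N : ℕ) : ℕ ⊕ ℕ → ℝ :=
  Sum.elim (fun k => acousticSymbol (k * Real.pi * mesh N))
    fun k => opticSymbol (k * Real.pi * mesh N)

/-- The frequency of a mode, scaled by `h`. -/
noncomputable def modeDispersion (N : ℕ) : ℕ ⊕ ℕ → ℝ :=
  Sum.elim (fun k => acousticDispersion (k * Real.pi * mesh N))
    fun k => opticDispersion (k * Real.pi * mesh N)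

/-- The eigenvector of a mode. -/
noncomputable def modeVec (N : ℕ) (m : ℕ ⊕ ℕ) : Vec N := rawMode N (modeNumber m) (modeSymbol N m)

lemma modeDispersion_sq (N : ℕ) (m : ℕ ⊕ ℕ) : modeDispersion N m ^ 2 = modeSymbol N m := by
  rcases m with k | k
  · exact acousticDispersion_sq _
  · exact opticDispersion_sq _

lemma isSymbolAt_modeSymbol (N : ℕ) (m : ℕ ⊕ ℕ) :
    IsSymbolAt (modeNumber m * Real.pi * mesh N) (modeSymbol N m) := by
  rcases m with k | k
  · exact isSymbolAt_acousticSymbol _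
  · exact isSymbolAt_opticSymbol _

lemma inl_mem_modeIndices {N k : ℕ} {ηa η₁ η₂ : ℝ} :
    Sum.inl k ∈ modeIndices N ηa η₁ η₂ ↔ (1 ≤ k ∧ k ≤ N) ∧ k * Real.pi * mesh N ≤ ηa := by
  rw [modeIndices, Finset.inl_mem_disjSum, Finset.mem_filter, Finset.mem_Icc]

lemma inr_mem_modeIndices {N k : ℕ} {ηa η₁ η₂ : ℝ} :
    Sum.inr k ∈ modeIndices N ηa η₁ η₂ ↔
      (1 ≤ k ∧ k ≤ N) ∧ η₁ ≤ k * Real.pi * mesh N ∧ k * Real.pi * mesh N ≤ η₂ := by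
  rw [modeIndices, Finset.inr_mem_disjSum, Finset.mem_filter, Finset.mem_Icc]

/-- Normalization only rescales a mode, so raw modes suffice; their norms reappear as weights in the
energy. -/
lemma exists_sum_of_mem_truncatedSpace {N : ℕ} {ηa η₁ η₂ : ℝ} {F : Vec N}
    (hF : F ∈ truncatedSpace N ηa η₁ η₂) :
    ∃ u : ℕ ⊕ ℕ → ℂ, F = ∑ m ∈ modeIndices N ηa η₁ η₂, u m • modeVec N m := by
  have hle : truncatedSpace N ηa η₁ η₂ ≤
      Submodule.span ℂ (modeVec N '' (modeIndices N ηa η₁ η₂ : Set (ℕ ⊕ ℕ))) := by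
    refine sup_le (Submodule.span_le.2 ?_) (Submodule.span_le.2 ?_)
    · rintro _ ⟨k, h1, h2, h3, rfl⟩
      exact Submodule.smul_mem _ _ (Submodule.subset_span
        ⟨Sum.inl k, inl_mem_modeIndices.2 ⟨⟨h1, h2⟩, h3⟩, rfl⟩)
    · rintro _ ⟨k, h1, h2, h3, h4, rfl⟩
      exact Submodule.smul_mem _ _ (Submodule.subset_span
        ⟨Sum.inr k, inr_mem_modeIndices.2 ⟨⟨h1, h2⟩, h3, h4⟩, rfl⟩)
  obtain ⟨u, hu⟩ := (Submodule.mem_span_image_finset_iff_exists_fun' ℂ).1 (hle hF)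
  exact ⟨u, hu.symm⟩

lemma sqrt_ten_lt_sqrt_twelve : Real.sqrt 10 < Real.sqrt 12 :=
  Real.sqrt_lt_sqrt (by norm_num) (by norm_num)

lemma acousticDispersion_le {η : ℝ} (hη : η ∈ Set.Icc 0 Real.pi) :
    acousticDispersion η ≤ Real.sqrt 10 := by
  rw [← acousticSymbol_pi]
  exact strictMonoOn_acousticDispersion.monotoneOn hη ⟨Real.pi_pos.le, le_rfl⟩ hη.2

lemma le_opticDispersion {η : ℝ} (hη : η ∈ Set.Icc 0 Real.pi) :
    Real.sqrt 12 ≤ opticDispersion η := by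
  rw [← opticSymbol_pi]
  exact strictAntiOn_opticDispersion.antitoneOn hη ⟨Real.pi_pos.le, le_rfl⟩ hη.2

section Gap

variable {N : ℕ} {ηa η₁ η₂ va vo g : ℝ}

/-- The acoustic branch starts at `λᵃ(0) = 0` and `k ≥ 1` moves at least `πh` away from it; the
optic branch stays above `√12`. This will separate frequencies of opposite signs. -/
lemma le_modeDispersion (hη₁ : 0 ≤ η₁) (hη₂ : η₂ ≤ Real.pi) (hva : 0 < va)
    (hA : ∀ x y, 0 ≤ x → x ≤ y → y ≤ ηa →
      va * (y - x) ≤ acousticDispersion y - acousticDispersion x)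
    (ga : g ≤ va * (Real.pi * mesh N))
    (gδ : g ≤ Real.sqrt 12 - Real.sqrt 10) {m : ℕ ⊕ ℕ} (hm : m ∈ modeIndices N ηa η₁ η₂) :
    g ≤ modeDispersion N m := by
  have hπh : 0 < Real.pi * mesh N := mul_pos Real.pi_pos (mesh_pos N)
  rcases m with k | k
  · obtain ⟨⟨h1, -⟩, h3⟩ := inl_mem_modeIndices.1 hm
    have hk : (1 : ℝ) ≤ k := by exact_mod_cast h1
    have h4 : Real.pi * mesh N ≤ k * Real.pi * mesh N := by nlinarith
    have h := hA 0 _ le_rfl (hπh.le.trans h4) h3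
    have h0 : acousticDispersion 0 = 0 := by simp [acousticDispersion, acousticSymbol_zero]
    rw [h0, sub_zero, sub_zero] at h
    exact ga.trans ((mul_le_mul_of_nonneg_left h4 hva.le).trans h)
  · obtain ⟨-, h3, h4⟩ := inr_mem_modeIndices.1 hm
    have := le_opticDispersion ⟨hη₁.trans h3, h4.trans hη₂⟩
    change g ≤ opticDispersion _
    linarith [Real.sqrt_nonneg 10]

/-- Inside a branch distinct wave numbers differ by at least `πh`, and the velocity bound applies.
Across branches, `λᵃ ≤ √10 < √12 ≤ λᵒ`. -/
lemma le_abs_modeDispersion_sub (hηa : ηa ≤ Real.pi) (hη₁ : 0 ≤ η₁) (hη₂ : η₂ ≤ Real.pi)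
    (hva : 0 < va) (hvo : 0 < vo)
    (hA : ∀ x y, 0 ≤ x → x ≤ y → y ≤ ηa →
      va * (y - x) ≤ acousticDispersion y - acousticDispersion x)
    (hO : ∀ x y, η₁ ≤ x → x ≤ y → y ≤ η₂ →
      vo * (y - x) ≤ opticDispersion x - opticDispersion y)
    (ga : g ≤ va * (Real.pi * mesh N)) (go : g ≤ vo * (Real.pi * mesh N))
    (gδ : g ≤ Real.sqrt 12 - Real.sqrt 10) {m m' : ℕ ⊕ ℕ} (hm : m ∈ modeIndices N ηa η₁ η₂)
    (hm' : m' ∈ modeIndices N ηa η₁ η₂) (hne : m ≠ m') :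
    g ≤ |modeDispersion N m - modeDispersion N m'| := by
  have hπh : 0 < Real.pi * mesh N := mul_pos Real.pi_pos (mesh_pos N)
  have hstep : ∀ k k' : ℕ, k < k' →
      Real.pi * mesh N ≤ k' * Real.pi * mesh N - k * Real.pi * mesh N := by
    intro k k' hkk
    have : (k : ℝ) + 1 ≤ k' := by exact_mod_cast hkk
    nlinarith
  have hnn : ∀ k : ℕ, 0 ≤ k * Real.pi * mesh N := fun k => by
    have := mesh_pos N; have := Real.pi_pos; positivity
  have hcross : ∀ k k' : ℕ, Sum.inl k ∈ modeIndices N ηa η₁ η₂ →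
      Sum.inr k' ∈ modeIndices N ηa η₁ η₂ →
      g ≤ modeDispersion N (Sum.inr k') - modeDispersion N (Sum.inl k) := by
    intro k k' hk hk'
    obtain ⟨-, h3⟩ := inl_mem_modeIndices.1 hk
    obtain ⟨-, h4, h5⟩ := inr_mem_modeIndices.1 hk'
    have a1 := acousticDispersion_le ⟨hnn k, h3.trans hηa⟩
    have a2 := le_opticDispersion ⟨hη₁.trans h4, h5.trans hη₂⟩
    change g ≤ opticDispersion _ - acousticDispersion _
    linarith
  have hac : ∀ k k' : ℕ, Sum.inl k' ∈ modeIndices N ηa η₁ η₂ → k < k' →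
      g ≤ modeDispersion N (Sum.inl k') - modeDispersion N (Sum.inl k) := by
    intro k k' hk' hkk
    obtain ⟨-, h3⟩ := inl_mem_modeIndices.1 hk'
    have h1 := hstep k k' hkk
    exact ga.trans ((mul_le_mul_of_nonneg_left h1 hva.le).trans
      (hA _ _ (hnn k) (by linarith) h3))
  have hop : ∀ k k' : ℕ, Sum.inr k ∈ modeIndices N ηa η₁ η₂ →
      Sum.inr k' ∈ modeIndices N ηa η₁ η₂ → k < k' →
      g ≤ modeDispersion N (Sum.inr k) - modeDispersion N (Sum.inr k') := by
    intro k k' hk hk' hkk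
    obtain ⟨-, h3, -⟩ := inr_mem_modeIndices.1 hk
    obtain ⟨-, -, h4⟩ := inr_mem_modeIndices.1 hk'
    have h1 := hstep k k' hkk
    exact go.trans ((mul_le_mul_of_nonneg_left h1 hvo.le).trans
      (hO _ _ h3 (by linarith) h4))
  rcases m with k | k <;> rcases m' with k' | k'
  · rcases lt_or_gt_of_ne (fun h => hne (congrArg Sum.inl h)) with h | h
    · rw [abs_sub_comm]; exact (hac k k' hm' h).trans (le_abs_self _)
    · exact (hac k' k hm h).trans (le_abs_self _)
  · rw [abs_sub_comm]; exact (hcross k k' hm hm').trans (le_abs_self _)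
  · exact (hcross k' k hm' hm).trans (le_abs_self _)
  · rcases lt_or_gt_of_ne (fun h => hne (congrArg Sum.inr h)) with h | h
    · exact (hop k k' hm hm' h).trans (le_abs_self _)
    · rw [abs_sub_comm]; exact (hop k' k hm' hm h).trans (le_abs_self _)

end Gap

/-- The indices of the time-harmonic components: every mode oscillates with both signs. -/
noncomputable def signedIndices (N : ℕ) (ηa η₁ η₂ : ℝ) : Finset (Bool × (ℕ ⊕ ℕ)) :=
  Finset.univ ×ˢ modeIndices N ηa η₁ η₂

/-- The frequencies of the time-harmonic components. -/
noncomputable def signedFrequency (N : ℕ) (i : Bool × (ℕ ⊕ ℕ)) : ℝ :=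
  if i.1 then modeDispersion N i.2 / mesh N else -(modeDispersion N i.2 / mesh N)

/-- Division by `h` turns increments of order `πh` into gaps independent of `h`; only the distance
between the branches still involves `h`, through `gδ`. Frequencies of opposite signs are even `2γ`
apart. -/
lemma signedFrequency_separated {N : ℕ} {ηa η₁ η₂ va vo γ : ℝ} (hηa : ηa ≤ Real.pi)
    (hη₁ : 0 ≤ η₁) (hη₂ : η₂ ≤ Real.pi) (hva : 0 < va) (hvo : 0 < vo)
    (hA : ∀ x y, 0 ≤ x → x ≤ y → y ≤ ηa →
      va * (y - x) ≤ acousticDispersion y - acousticDispersion x)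
    (hO : ∀ x y, η₁ ≤ x → x ≤ y → y ≤ η₂ →
      vo * (y - x) ≤ opticDispersion x - opticDispersion y)
    (hγ : 0 < γ) (ga : γ ≤ Real.pi * va) (go : γ ≤ Real.pi * vo)
    (gδ : γ * mesh N ≤ Real.sqrt 12 - Real.sqrt 10) :
    ∀ i ∈ signedIndices N ηa η₁ η₂, ∀ j ∈ signedIndices N ηa η₁ η₂, i ≠ j →
      γ ≤ |signedFrequency N i - signedFrequency N j| := by
  have hh := mesh_pos N
  have ga' : γ * mesh N ≤ va * (Real.pi * mesh N) := by nlinarith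
  have go' : γ * mesh N ≤ vo * (Real.pi * mesh N) := by nlinarith
  have hpos : ∀ m ∈ modeIndices N ηa η₁ η₂, γ ≤ modeDispersion N m / mesh N := fun m hm =>
    (le_div_iff₀ hh).2 (le_modeDispersion hη₁ hη₂ hva hA ga' gδ hm)
  have hdiff : ∀ m ∈ modeIndices N ηa η₁ η₂, ∀ m' ∈ modeIndices N ηa η₁ η₂, m ≠ m' →
      γ ≤ |modeDispersion N m / mesh N - modeDispersion N m' / mesh N| := by
    intro m hm m' hm' hne
    rw [← sub_div, abs_div, abs_of_pos hh, le_div_iff₀ hh]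
    exact le_abs_modeDispersion_sub hηa hη₁ hη₂ hva hvo hA hO ga' go' gδ hm hm' hne
  rintro ⟨b, m⟩ hm ⟨b', m'⟩ hm' hne
  replace hm := (Finset.mem_product.1 hm).2
  replace hm' := (Finset.mem_product.1 hm').2
  have p1 := hpos m hm
  have p2 := hpos m' hm'
  cases b <;> cases b' <;> simp only [signedFrequency, if_true, Bool.false_eq_true, if_false]
  · rw [neg_sub_neg, abs_sub_comm]
    exact hdiff m hm m' hm' fun h => hne (by rw [h])
  · exact le_trans (by linarith) (neg_le_abs _)
  · exact le_trans (by linarith) (le_abs_self _)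
  · exact hdiff m hm m' hm' fun h => hne (by rw [h])

/-- For the filtered modes the boundary observation is comparable to the energy. -/
lemma exists_modeSymbol_le_nodeValue {ηa η₁ η₂ : ℝ} (hηa : 0 < ηa ∧ ηa < Real.pi)
    (hη₁ : 0 < η₁) (hη₁₂ : η₁ ≤ η₂) (hη₂ : η₂ < Real.pi) :
    ∃ κ : ℝ, 0 < κ ∧ ∀ N, ∀ m ∈ modeIndices N ηa η₁ η₂,
      κ * (normSqZero (modeVec N m) * modeSymbol N m) ≤ nodeValue N (modeNumber m) ^ 2 := by
  have hca : 0 < Real.cos (ηa / 2) :=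
    Real.cos_pos_of_mem_Ioo ⟨by linarith [Real.pi_pos, hηa.1], by linarith [hηa.2]⟩
  have hLa : acousticSymbol ηa < 10 := by
    rw [← acousticSymbol_pi]
    exact strictMonoOn_acousticSymbol ⟨hηa.1.le, hηa.2.le⟩ ⟨Real.pi_pos.le, le_rfl⟩ hηa.2
  obtain ⟨σ, -, hσ, hσle⟩ := exists_isLeast_of_eqOn (f := fun x => Real.sin x ^ 2)
    (g := fun x => Real.sin x ^ 2) (by fun_prop) hη₁₂ (fun _ _ => rfl) (fun x hx =>
      pow_pos (Real.sin_pos_of_pos_of_lt_pi (hη₁.trans_le hx.1) (hx.2.trans_lt hη₂)) 2)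
  -- This bounds the squared midpoint factor on the acoustic part, where `40 + Λ ≤ 50` and `10 - Λ`
  -- is at least its value at the cutoff.
  set A : ℝ := (50 / (4 * (10 - acousticSymbol ηa))) ^ 2 with hAdef
  set Ba : ℝ := 4 / 3 * (1 + A) with hBa
  have hBa0 : 0 < Ba := by positivity
  -- On the optic branch `12 ≤ Λ ≤ 60`, so the midpoint factor has modulus at most `100/8`.
  set Bo : ℝ := 4 / 3 * (1 + (100 / 8) ^ 2) with hBo
  have hBo0 : 0 < Bo := by positivity
  refine ⟨min (2 / 5 * Real.cos (ηa / 2) ^ 2 / Ba) (σ / (60 * Bo)),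
    lt_min (by positivity) (by positivity), fun N m hm => ?_⟩
  rw [nodeValue_sq]
  rcases m with k | k
  · obtain ⟨⟨h1, h2⟩, h3⟩ := inl_mem_modeIndices.1 hm
    change _ * (normSqZero (rawMode N k (acousticSymbol (k * Real.pi * mesh N))) *
      acousticSymbol (k * Real.pi * mesh N)) ≤ Real.sin (k * Real.pi * mesh N) ^ 2
    set η : ℝ := k * Real.pi * mesh N with hη
    have hη0 : 0 ≤ η := by have := mesh_pos N; have := Real.pi_pos; positivity
    have hL0 := acousticSymbol_nonneg η
    have hL : acousticSymbol η ≤ acousticSymbol ηa :=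
      strictMonoOn_acousticSymbol.monotoneOn ⟨hη0, h3.trans hηa.2.le⟩ ⟨hηa.1.le, hηa.2.le⟩ h3
    have hn : normSqZero (rawMode N k (acousticSymbol η)) ≤ Ba := by
      apply normSqZero_rawMode_le
      have hp : 0 < 10 - acousticSymbol ηa := by linarith
      have hp' : 0 < 10 - acousticSymbol η := by linarith
      apply pow_le_pow_left₀ (by positivity)
      apply div_le_div₀ <;> linarith
    have hc : Real.cos (ηa / 2) ≤ Real.cos (η / 2) :=
      Real.cos_le_cos_of_nonneg_of_le_pi (by linarith) (by linarith [hηa.2, Real.pi_pos])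
        (by linarith)
    -- The squared sine is `Λᵃ` times `cos²(η/2) · den/30`. With `den ≥ 12` this produces the
    -- constant `2/5`, and the small factors at `0` cancel.
    have hsin : Real.sin η ^ 2 =
        Real.cos (η / 2) ^ 2 * (acousticSymbol η * acousticDen η) / 30 := by
      rw [acousticSymbol_mul_den]
      have : Real.sin η = 2 * Real.sin (η / 2) * Real.cos (η / 2) := by
        rw [← Real.sin_two_mul]; congr 1; ring
      rw [this]; ring
    calc _ ≤ 2 / 5 * Real.cos (ηa / 2) ^ 2 / Ba * (Ba * acousticSymbol η) := by
          have := (by norm_num : (0 : ℝ) < 1 / 30).trans_le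
            (normSqZero_rawMode_ge N k (acousticSymbol η) h1 h2)
          gcongr
          exact min_le_left _ _
      _ = Real.cos (ηa / 2) ^ 2 * (acousticSymbol η * 12) / 30 := by field_simp; ring
      _ ≤ _ := by
          rw [hsin]
          have := acousticDen_ge η
          gcongr
  · obtain ⟨⟨h1, h2⟩, h3, h4⟩ := inr_mem_modeIndices.1 hm
    change _ * (normSqZero (rawMode N k (opticSymbol (k * Real.pi * mesh N))) *
      opticSymbol (k * Real.pi * mesh N)) ≤ Real.sin (k * Real.pi * mesh N) ^ 2
    set η : ℝ := k * Real.pi * mesh N with hη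
    have hηI : η ∈ Set.Icc 0 Real.pi := ⟨hη₁.le.trans h3, h4.trans hη₂.le⟩
    have hL1 : 12 ≤ opticSymbol η := by
      rw [← opticSymbol_pi]
      exact strictAntiOn_opticSymbol.antitoneOn hηI ⟨Real.pi_pos.le, le_rfl⟩ hηI.2
    have hL2 : opticSymbol η ≤ 60 := by
      rw [← opticSymbol_zero]
      exact strictAntiOn_opticSymbol.antitoneOn ⟨le_rfl, Real.pi_pos.le⟩ hηI hηI.1
    have hn : normSqZero (rawMode N k (opticSymbol η)) ≤ Bo := by
      apply normSqZero_rawMode_le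
      rw [← neg_sq, ← div_neg]
      apply pow_le_pow_left₀ (div_nonneg (by linarith) (by linarith))
      apply div_le_div₀ <;> linarith
    calc _ ≤ σ / (60 * Bo) * (Bo * 60) := by
          have := (by norm_num : (0 : ℝ) < 1 / 30).trans_le
            (normSqZero_rawMode_ge N k (opticSymbol η) h1 h2)
          have := opticSymbol_pos η
          gcongr
          exact min_le_right _ _
      _ = σ := by field_simp
      _ ≤ _ := hσle η ⟨h3, h4⟩

/-- As the squared norm is at least `1/30`, it suffices that `sin² η ≤ Λ`. On the acoustic branch
`sin² η ≤ 4 sin²(η/2) ≤ Λ` because the denominator is at most `30`; on the optic one `Λ ≥ 12`. -/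
lemma nodeValue_le_modeSymbol {N : ℕ} {ηa η₁ η₂ : ℝ} (hη₁ : 0 ≤ η₁) (hη₂ : η₂ ≤ Real.pi)
    {m : ℕ ⊕ ℕ} (hm : m ∈ modeIndices N ηa η₁ η₂) :
    nodeValue N (modeNumber m) ^ 2 ≤ 30 * (normSqZero (modeVec N m) * modeSymbol N m) := by
  rw [nodeValue_sq]
  rcases m with k | k
  · obtain ⟨⟨h1, h2⟩, -⟩ := inl_mem_modeIndices.1 hm
    have hn := normSqZero_rawMode_ge N k (acousticSymbol (k * Real.pi * mesh N)) h1 h2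
    change Real.sin (k * Real.pi * mesh N) ^ 2 ≤
      30 * (normSqZero (rawMode N k (acousticSymbol (k * Real.pi * mesh N))) *
        acousticSymbol (k * Real.pi * mesh N))
    set η : ℝ := k * Real.pi * mesh N with hη
    have hL0 := acousticSymbol_nonneg η
    have hsin : Real.sin η ^ 2 ≤ acousticSymbol η := by
      have : Real.sin η = 2 * Real.sin (η / 2) * Real.cos (η / 2) := by
        rw [← Real.sin_two_mul]; congr 1; ring
      rw [this]
      have h3 := acousticSymbol_mul_den η
      have h4 := acousticDen_le η
      have h5 := Real.cos_sq_le_one (η / 2)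
      nlinarith [sq_nonneg (Real.sin (η / 2))]
    nlinarith
  · obtain ⟨⟨h1, h2⟩, h3, h4⟩ := inr_mem_modeIndices.1 hm
    have hn := normSqZero_rawMode_ge N k (opticSymbol (k * Real.pi * mesh N)) h1 h2
    change Real.sin (k * Real.pi * mesh N) ^ 2 ≤
      30 * (normSqZero (rawMode N k (opticSymbol (k * Real.pi * mesh N))) *
        opticSymbol (k * Real.pi * mesh N))
    set η : ℝ := k * Real.pi * mesh N with hη
    have hηI : η ∈ Set.Icc 0 Real.pi := ⟨hη₁.trans h3, h4.trans hη₂⟩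
    have hL1 : 12 ≤ opticSymbol η := by
      rw [← opticSymbol_pi]
      exact strictAntiOn_opticSymbol.antitoneOn hηI ⟨Real.pi_pos.le, le_rfl⟩ hηI.2
    nlinarith [Real.sin_sq_le_one η]

open Complex in
/-- The observation of a solution is the mean square of a nonharmonic trigonometric sum whose
coefficients are controlled by the energy, from above and from below. -/
lemma IsSolution.exists_expSum {N : ℕ} {T ηa η₁ η₂ va vo κ : ℝ} (hT : 0 < T)
    (hηa : ηa < Real.pi) (hη₁ : 0 ≤ η₁) (hη₂ : η₂ ≤ Real.pi) (hva : 0 < va) (hvo : 0 < vo)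
    (hA : ∀ x y, 0 ≤ x → x ≤ y → y ≤ ηa →
      va * (y - x) ≤ acousticDispersion y - acousticDispersion x)
    (hO : ∀ x y, η₁ ≤ x → x ≤ y → y ≤ η₂ →
      vo * (y - x) ≤ opticDispersion x - opticDispersion y)
    (hκ : ∀ m ∈ modeIndices N ηa η₁ η₂,
      κ * (normSqZero (modeVec N m) * modeSymbol N m) ≤ nodeValue N (modeNumber m) ^ 2)
    {U₀ U₁ : Vec N} {U : ℝ → Vec N} (h₀ : U₀ ∈ truncatedSpace N ηa η₁ η₂)
    (h₁ : U₁ ∈ truncatedSpace N ηa η₁ η₂) (hU : IsSolution N T U₀ U₁ U) :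
    ∃ c : Bool × (ℕ ⊕ ℕ) → ℂ,
      observation T U = ∫ t in (0 : ℝ)..T,
        ‖expSum (signedIndices N ηa η₁ η₂) (signedFrequency N) c t‖ ^ 2 ∧
      κ * energy U₀ U₁ ≤ ∑ i ∈ signedIndices N ηa η₁ η₂, ‖c i‖ ^ 2 ∧
      ∑ i ∈ signedIndices N ηa η₁ η₂, ‖c i‖ ^ 2 ≤ 30 * energy U₀ U₁ := by
  have hh := mesh_pos N
  have hδ : 0 < Real.sqrt 12 - Real.sqrt 10 := sub_pos.2 sqrt_ten_lt_sqrt_twelve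
  -- Any positive gap for this fixed `N` will do: it only serves to show that the frequencies are
  -- positive and distinct.
  set g := min (min (va * (Real.pi * mesh N)) (vo * (Real.pi * mesh N)))
    (Real.sqrt 12 - Real.sqrt 10) with hg
  have hπh : 0 < Real.pi * mesh N := mul_pos Real.pi_pos hh
  have hg0 : 0 < g := lt_min (lt_min (by positivity) (by positivity)) hδ
  have ga : g ≤ va * (Real.pi * mesh N) := (min_le_left _ _).trans (min_le_left _ _)
  have go : g ≤ vo * (Real.pi * mesh N) := (min_le_left _ _).trans (min_le_right _ _)
  have gδ : g ≤ Real.sqrt 12 - Real.sqrt 10 := min_le_right _ _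
  set s := modeIndices N ηa η₁ η₂ with hs
  have hpos : ∀ m ∈ s, 0 < modeDispersion N m := fun m hm =>
    hg0.trans_le (le_modeDispersion hη₁ hη₂ hva hA ga gδ hm)
  have hinj : ∀ m ∈ s, ∀ m' ∈ s, modeDispersion N m = modeDispersion N m' → m = m' := by
    intro m hm m' hm' h
    by_contra hne
    have := le_abs_modeDispersion_sub hηa.le hη₁ hη₂ hva hvo hA hO ga go gδ hm hm' hne
    rw [h, sub_self, abs_zero] at this
    linarith
  have hten : ∀ m ∈ s, modeSymbol N m ≠ 10 := by
    intro m hm h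
    rcases m with k | k
    · obtain ⟨-, h3⟩ := inl_mem_modeIndices.1 hm
      have h0 : 0 ≤ k * Real.pi * mesh N := by have := Real.pi_pos; positivity
      have := strictMonoOn_acousticSymbol ⟨h0, h3.trans hηa.le⟩ ⟨Real.pi_pos.le, le_rfl⟩
        (h3.trans_lt hηa)
      rw [acousticSymbol_pi] at this
      exact this.ne h
    · obtain ⟨-, h3, h4⟩ := inr_mem_modeIndices.1 hm
      have := strictAntiOn_opticSymbol.antitoneOn ⟨hη₁.trans h3, h4.trans hη₂⟩
        ⟨Real.pi_pos.le, le_rfl⟩ (h4.trans hη₂)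
      rw [opticSymbol_pi] at this
      change opticSymbol _ = 10 at h
      linarith
  set ω : ℕ ⊕ ℕ → ℝ := fun m => modeDispersion N m / mesh N with hω
  have hωsq : ∀ m, ω m ^ 2 = modeSymbol N m / mesh N ^ 2 := fun m => by
    rw [hω, div_pow, modeDispersion_sq]
  have hφ : ∀ m ∈ s, act (stiffnessMatrix N) (modeVec N m) =
      ((ω m ^ 2 : ℝ) : ℂ) • act (massMatrix N) (modeVec N m) := fun m hm => by
    rw [hωsq]
    exact act_stiffnessMatrix_rawMode N _ (hten m hm) (isSymbolAt_modeSymbol N m)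
  have hωinj : Set.InjOn (fun m => ω m ^ 2) s := by
    intro m hm m' hm' h
    refine hinj m hm m' hm' ?_
    have h1 := (pow_left_inj₀ (div_pos (hpos m hm) hh).le (div_pos (hpos m' hm') hh).le
      two_ne_zero).1 h
    exact (div_left_inj' hh.ne').1 h1
  obtain ⟨p, q, hexp, hE⟩ := hU.exists_expansion hφ hωinj (fun m hm => div_pos (hpos m hm) hh)
    (exists_sum_of_mem_truncatedSpace h₀) (exists_sum_of_mem_truncatedSpace h₁)
  have hsum : ∑ i ∈ signedIndices N ηa η₁ η₂,
      ‖((nodeValue N (modeNumber i.2) / mesh N : ℝ) : ℂ) * (if i.1 then p i.2 else q i.2)‖ ^ 2 =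
      ∑ m ∈ s, nodeValue N (modeNumber m) ^ 2 / mesh N ^ 2 * (‖p m‖ ^ 2 + ‖q m‖ ^ 2) := by
    rw [signedIndices, Finset.sum_product_right]
    refine Finset.sum_congr rfl fun m _ => ?_
    rw [Fintype.sum_bool]
    simp only [if_true, Bool.false_eq_true, if_false, norm_mul, norm_real, Real.norm_eq_abs,
      mul_pow, sq_abs]
    ring
  refine ⟨fun i => ((nodeValue N (modeNumber i.2) / mesh N : ℝ) : ℂ) *
    (if i.1 then p i.2 else q i.2), ?_, ?_, ?_⟩
  · refine intervalIntegral.integral_congr fun t ht => ?_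
    rw [Set.uIcc_of_le hT.le] at ht
    rw [hexp t ht]
    simp only [modeVec]
    rw [euclNormSq_act_observationMatrix_sum, expSum, signedIndices, Finset.sum_product_right]
    congr 2
    refine Finset.sum_congr rfl fun m _ => ?_
    rw [Fintype.sum_bool]
    simp only [signedFrequency, if_true, Bool.false_eq_true, if_false]
    ring
  · rw [hsum, hE, Finset.mul_sum]
    refine Finset.sum_le_sum fun m hm => ?_
    rw [hωsq]
    calc _ = κ * (normSqZero (modeVec N m) * modeSymbol N m) / mesh N ^ 2 *
          (‖p m‖ ^ 2 + ‖q m‖ ^ 2) := by ring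
      _ ≤ _ := by
          gcongr
          exact hκ m hm
  · rw [hsum, hE, Finset.mul_sum]
    refine Finset.sum_le_sum fun m hm => ?_
    rw [hωsq]
    calc _ ≤ 30 * (normSqZero (modeVec N m) * modeSymbol N m) / mesh N ^ 2 *
          (‖p m‖ ^ 2 + ‖q m‖ ^ 2) := by
          gcongr
          exact nodeValue_le_modeSymbol hη₁ hη₂ hm
      _ = _ := by ring

/-- A property of positive constants that holds eventually uniformly holds uniformly. -/
lemma exists_uniform_const {P : ℕ → ℝ → Prop}
    (hanti : ∀ N (a b : ℝ), a ≤ b → P N b → P N a) (h : ∀ N, ∃ c, 0 < c ∧ P N c)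
    (N₀ : ℕ) (h' : ∃ c, 0 < c ∧ ∀ N, N₀ ≤ N → P N c) : ∃ c, 0 < c ∧ ∀ N, P N c := by
  choose c hc hP using h
  obtain ⟨c', hc', hP'⟩ := h'
  refine ⟨min c' ((Finset.range (N₀ + 1)).inf' ⟨0, by simp⟩ c),
    lt_min hc' ((Finset.lt_inf'_iff _).2 fun N _ => hc N), fun N => ?_⟩
  rcases le_total N₀ N with hN | hN
  · exact hanti N _ _ (min_le_left _ _) (hP' N hN)
  · exact hanti N _ _ ((min_le_right _ _).trans
      (Finset.inf'_le _ (Finset.mem_range.2 (by omega)))) (hP N)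

end P2Wave

/-! ### Uniform observability and admissibility. -/

theorem mainTheorem2 (La Lm Lp : ℝ) (hLa0 : 0 < La) (hLa : La < 10)
    (hLm : 12 < Lm) (hLmp : Lm ≤ Lp) (hLp : Lp < 60) :
    ∃ va vo : ℝ,
      IsLeast (P2Wave.acousticVelocity '' Set.Icc 0 (P2Wave.acousticWaveNumber La)) va ∧
      IsLeast (P2Wave.opticVelocity ''
        Set.Icc (P2Wave.opticWaveNumber Lp) (P2Wave.opticWaveNumber Lm)) vo ∧
      0 < va ∧ 0 < vo ∧
      (∀ T : ℝ, 2 / min va vo < T → ∃ C : ℝ, 0 < C ∧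
        ∀ (N : ℕ) (U₀ U₁ : P2Wave.Vec N) (U : ℝ → P2Wave.Vec N),
          U₀ ∈ P2Wave.truncatedSpace N (P2Wave.acousticWaveNumber La)
            (P2Wave.opticWaveNumber Lp) (P2Wave.opticWaveNumber Lm) →
          U₁ ∈ P2Wave.truncatedSpace N (P2Wave.acousticWaveNumber La)
            (P2Wave.opticWaveNumber Lp) (P2Wave.opticWaveNumber Lm) →
          P2Wave.IsSolution N T U₀ U₁ U →
          P2Wave.energy U₀ U₁ ≤ C * P2Wave.observation T U) ∧
      (∀ T : ℝ, 0 < T → ∃ c : ℝ, 0 < c ∧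
        ∀ (N : ℕ) (U₀ U₁ : P2Wave.Vec N) (U : ℝ → P2Wave.Vec N),
          U₀ ∈ P2Wave.truncatedSpace N (P2Wave.acousticWaveNumber La)
            (P2Wave.opticWaveNumber Lp) (P2Wave.opticWaveNumber Lm) →
          U₁ ∈ P2Wave.truncatedSpace N (P2Wave.acousticWaveNumber La)
            (P2Wave.opticWaveNumber Lp) (P2Wave.opticWaveNumber Lm) →
          P2Wave.IsSolution N T U₀ U₁ U →
          c * P2Wave.observation T U ≤ P2Wave.energy U₀ U₁) := by
  obtain ⟨va, hva_least, hva, hA⟩ := P2Wave.exists_min_acousticVelocity hLa0 hLa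
  obtain ⟨vo, hvo_least, hvo, hO⟩ := P2Wave.exists_min_opticVelocity hLm hLmp hLp
  obtain ⟨hma, -⟩ := P2Wave.acousticWaveNumber_spec hLa0 hLa
  obtain ⟨hmm, -⟩ := P2Wave.opticWaveNumber_spec hLm (hLmp.trans_lt hLp)
  obtain ⟨hmp, -⟩ := P2Wave.opticWaveNumber_spec (hLm.trans_le hLmp) hLp
  have hanti := P2Wave.opticWaveNumber_anti hLm hLmp hLp
  set ηa := P2Wave.acousticWaveNumber La
  set η₁ := P2Wave.opticWaveNumber Lp
  set η₂ := P2Wave.opticWaveNumber Lm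
  obtain ⟨κ, hκ0, hκ⟩ := P2Wave.exists_modeSymbol_le_nodeValue hma hmp.1 hanti hmm.2
  have hδ : 0 < Real.sqrt 12 - Real.sqrt 10 := sub_pos.2 P2Wave.sqrt_ten_lt_sqrt_twelve
  have hv : 0 < min va vo := lt_min hva hvo
  have hπ := Real.pi_pos
  have hsep := fun (N : ℕ) (γ : ℝ) (hγ : 0 < γ) (h1 : γ ≤ Real.pi * min va vo) =>
    P2Wave.signedFrequency_separated (N := N) hma.2.le hmp.1.le hmm.2.le hva hvo hA hO hγ
      (h1.trans (mul_le_mul_of_nonneg_left (min_le_left _ _) hπ.le))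
      (h1.trans (mul_le_mul_of_nonneg_left (min_le_right _ _) hπ.le))
  -- As `h ≤ 1`, this gap is valid for every `N`. It suffices for admissibility and for
  -- distinctness, but may be too small for the time `T*`.
  set γ₀ := min (Real.pi * min va vo) (Real.sqrt 12 - Real.sqrt 10) with hγ₀
  have hγ₀0 : 0 < γ₀ := lt_min (by positivity) hδ
  have hsep₀ := fun N => hsep N γ₀ hγ₀0 (min_le_left _ _)
    ((mul_le_of_le_one_right hγ₀0.le (P2Wave.mesh_le_one N)).trans (min_le_right _ _))
  refine ⟨va, vo, hva_least, hvo_least, hva, hvo, fun T hT => ?_, fun T hT => ?_⟩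
  · have hT0 : 0 < T := lt_trans (by positivity) hT
    -- From `N₀` on, the distance between the branches exceeds `π min(vᵃ, vᵒ)`, so the full gap is
    -- available and Ingham's condition reads `T > T*`. Smaller `N` are finitely many.
    obtain ⟨N₀, hN₀⟩ := exists_nat_ge (Real.pi * min va vo / (Real.sqrt 12 - Real.sqrt 10))
    obtain ⟨c₀, hc₀, hobs⟩ := P2Wave.exists_uniform_const
      (P := fun N C => ∀ c : Bool × (ℕ ⊕ ℕ) → ℂ,
        C * ∑ i ∈ P2Wave.signedIndices N ηa η₁ η₂, ‖c i‖ ^ 2 ≤ ∫ t in (0 : ℝ)..T,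
          ‖expSum (P2Wave.signedIndices N ηa η₁ η₂) (P2Wave.signedFrequency N) c t‖ ^ 2)
      (fun N a b hab h c => le_trans
        (mul_le_mul_of_nonneg_right hab (Finset.sum_nonneg fun _ _ => by positivity)) (h c))
      (fun N => exists_expSum_lower_bound _ _ (fun i hi j hj hij => by
        by_contra hne
        have := hsep₀ N i hi j hj hne
        rw [hij, sub_self, abs_zero] at this
        linarith) hT0) N₀
      (by
        have hT' : 2 * Real.pi / (Real.pi * min va vo) < T := by
          rwa [mul_comm 2, mul_div_mul_left _ _ hπ.ne']
        refine ⟨_, ingham_inverse_const_pos (by positivity) hT', fun N hN c =>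
          ingham_inverse _ _ c (by positivity) hT' (hsep N _ (by positivity) le_rfl ?_)⟩
        have h1 : Real.pi * min va vo / (Real.sqrt 12 - Real.sqrt 10) ≤ (N : ℝ) + 1 := by
          have : (N₀ : ℝ) ≤ N := by exact_mod_cast hN
          linarith
        rw [div_le_iff₀ hδ] at h1
        have h2 := P2Wave.mesh_mul N
        have h3 := P2Wave.mesh_pos N
        calc _ ≤ ((N : ℝ) + 1) * (Real.sqrt 12 - Real.sqrt 10) * P2Wave.mesh N := by gcongr
          _ = _ := by linear_combination (Real.sqrt 12 - Real.sqrt 10) * h2)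
    refine ⟨1 / (c₀ * κ), by positivity, fun N U₀ U₁ U h₀ h₁ hU => ?_⟩
    obtain ⟨c, e1, e2, -⟩ := hU.exists_expSum hT0 hma.2 hmp.1.le hmm.2.le hva hvo hA hO
      (hκ N) h₀ h₁
    have := hobs N c
    rw [e1, one_div, ← div_eq_inv_mul, le_div_iff₀ (by positivity)]
    calc _ = c₀ * (κ * P2Wave.energy U₀ U₁) := by ring
      _ ≤ _ := (mul_le_mul_of_nonneg_left e2 hc₀.le).trans this
  · obtain ⟨C, hC, hdir⟩ := ingham_direct hγ₀0 hT
    refine ⟨1 / (C * 30), by positivity, fun N U₀ U₁ U h₀ h₁ hU => ?_⟩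
    obtain ⟨c, e1, -, e3⟩ := hU.exists_expSum hT hma.2 hmp.1.le hmm.2.le hva hvo hA hO
      (hκ N) h₀ h₁
    have := hdir _ _ c (hsep₀ N)
    rw [e1, one_div, ← div_eq_inv_mul, div_le_iff₀ (by positivity)]
    calc _ ≤ C * (30 * P2Wave.energy U₀ U₁) :=
          this.trans (mul_le_mul_of_nonneg_left e3 hC.le)
      _ = _ := by ring
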